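/- For a finite group $G$ let $G$ act trivially on $\mathbb{C}^\times$, and for a $2$-cocycle $\alpha\in Z^2(G,\mathbb{C}^\times)$ let $[\alpha]$ be its class in $H^2(G,\mathbb{C}^\times)$ and let $\mathbb{C}^\alpha G$ be the twisted group algebra, i.e. the complex algebra with basis $(u_g)_{g\in G}$ and multiplication $u_g u_h=\alpha(g,h)u_{gh}$; up to isomorphism it depends only on $[\alpha]$. Write $G\sim_{\mathbb{C}}H$ if there is a group isomorphism $\psi\colon H^2(G,\mathbb{C}^\times)\to H^2(H,\mathbb{C}^\times)$ such that $\mathbb{C}^\alpha G\cong\mathbb{C}^\beta H$ as $\mathbb{C}$-algebras whenever $\psi([\alpha])=[\beta]$. The equivalence classes of $\sim_{\mathbb{C}}$ on the groups of a given order are called $\mathbb{C}$-twist isomorphism classes. A non-abelian group $G$ of order $p^n$ ($p$ prime) has generalized corank $s(G)$ if $|H^2(G,\mathbb{C}^\times)|=p^{\frac{(n-1)(n-2)}{2}+1-s(G)}$. Lemma. Let $p$ be a prime and let $G$ be a non-abelian group of order $p^n$ with $s(G)\in\{0,1\}$. Then the $\mathbb{C}$-twist isomorphism class of $G$ consists of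 a single group up to isomorphism: for every group $H$ of order $p^n$, $G\sim_{\mathbb{C}}H$ if and only if $G\cong H$. -/

import Mathlib

noncomputable section

/-- The unit group `Rˣ`, written additively, as a trivial `G`-module. -/
abbrev unitsRep (R G : Type) [CommRing R] [Group G] : Rep ℤ G :=
  Rep.trivial ℤ G (Additive Rˣ)

/-- The group `Z²(G, Rˣ)` of 2-cocycles for the trivial action of `G` on `Rˣ`. -/
abbrev TwoCocycle (R G : Type) [CommRing R] [Group G] : Type :=
  groupCohomology.cocycles₂ (unitsRep R G)

/-- The second cohomology group `H²(G, Rˣ)` for the trivial action of `G` on `Rˣ`. It is written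
additively; for `R = ℂ` it is the Schur multiplier of `G`. -/
abbrev SecondCohomology (R G : Type) [CommRing R] [Group G] : Type :=
  groupCohomology.H2 (unitsRep R G)

namespace TwoCocycle

variable {R G : Type} [CommRing R] [Group G]

/-- The value `α(g, h) ∈ Rˣ` of a 2-cocycle. -/
def val (α : TwoCocycle R G) (g h : G) : Rˣ := Additive.toMul (α (g, h))

/-- The cohomology class `[α]` of a 2-cocycle. -/
def cohomologyClass (α : TwoCocycle R G) : SecondCohomology R G :=
  (groupCohomology.H2π (unitsRep R G)).hom α

theorem val_mul_val (α : TwoCocycle R G) (g h j : G) :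
    α.val (g * h) j * α.val g h = α.val h j * α.val g (h * j) :=
  (groupCohomology.mem_cocycles₂_iff (A := unitsRep R G) α).1 α.2 g h j

theorem val_one_left (α : TwoCocycle R G) (g : G) : α.val 1 g = α.val 1 1 :=
  groupCohomology.cocycles₂_map_one_fst (A := unitsRep R G) α g

theorem val_one_right (α : TwoCocycle R G) (g : G) : α.val g 1 = α.val 1 1 :=
  groupCohomology.cocycles₂_map_one_snd (A := unitsRep R G) α g

end TwoCocycle

/-- The twisted group algebra `R^α G`: the free `R`-module on symbols `u_g`, `g ∈ G`, with
multiplication the `R`-bilinear extension of `u_g * u_h = α(g, h) u_{gh}`. -/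
def TwistedGroupAlgebra {R G : Type} [CommRing R] [Group G] (_α : TwoCocycle R G) : Type :=
  G →₀ R

namespace TwistedGroupAlgebra

variable {R G : Type} [CommRing R] [Group G] (α : TwoCocycle R G)

instance : AddCommGroup (TwistedGroupAlgebra α) := inferInstanceAs (AddCommGroup (G →₀ R))

instance : Module R (TwistedGroupAlgebra α) := inferInstanceAs (Module R (G →₀ R))

/-- The basis `(u_g)` of `R^α G`. -/
def basis : Module.Basis G R (TwistedGroupAlgebra α) :=
  Module.Basis.ofRepr (LinearEquiv.refl R (G →₀ R))

/-- The multiplication of `R^α G` as a bilinear map. -/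
def mulLin : TwistedGroupAlgebra α →ₗ[R] TwistedGroupAlgebra α →ₗ[R] TwistedGroupAlgebra α :=
  (basis α).constr R fun g => (basis α).constr R fun h => (α.val g h : R) • basis α (g * h)

instance : Mul (TwistedGroupAlgebra α) := ⟨fun x y => mulLin α x y⟩

/-- The identity of `R^α G` is `α(1, 1)⁻¹ u_1`. -/
instance : One (TwistedGroupAlgebra α) := ⟨((α.val 1 1)⁻¹ : Rˣ) • basis α 1⟩

theorem mul_def (x y : TwistedGroupAlgebra α) : x * y = mulLin α x y := rfl

theorem one_def : (1 : TwistedGroupAlgebra α) = (((α.val 1 1)⁻¹ : Rˣ) : R) • basis α 1 := rfl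

theorem mulLin_basis (g h : G) :
    mulLin α (basis α g) (basis α h) = (α.val g h : R) • basis α (g * h) := by
  simp [mulLin]

theorem basis_mul_basis (g h : G) :
    basis α g * basis α h = (α.val g h : R) • basis α (g * h) :=
  mulLin_basis α g h

theorem mulLin_assoc (x y z : TwistedGroupAlgebra α) :
    mulLin α (mulLin α x y) z = mulLin α x (mulLin α y z) := by
  have h1 (g h : G) : (mulLin α) (mulLin α (basis α g) (basis α h)) =
      mulLin α (basis α g) ∘ₗ mulLin α (basis α h) := (basis α).ext fun j => by
    have := congrArg (Units.val) (α.val_mul_val g h j)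
    simp only [Units.val_mul] at this
    simp only [LinearMap.comp_apply, mulLin_basis, map_smul, LinearMap.smul_apply, smul_smul,
      mul_assoc g h j]
    rw [mul_comm, this]
  have h2 (g : G) : (mulLin α) ∘ₗ (mulLin α (basis α g)) =
      (LinearMap.llcomp R _ _ _ (mulLin α (basis α g))) ∘ₗ mulLin α := (basis α).ext fun h => h1 g h
  have h3 : ((mulLin α).flip z) ∘ₗ ((mulLin α).flip y) = (mulLin α).flip (mulLin α y z) :=
    (basis α).ext fun g => LinearMap.congr_fun (LinearMap.congr_fun (h2 g) y) z
  exact LinearMap.congr_fun h3 x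

instance : Ring (TwistedGroupAlgebra α) :=
  { (inferInstance : AddCommGroup (TwistedGroupAlgebra α)) with
    mul := (· * ·)
    one := 1
    left_distrib := fun x y z => by simp [mul_def]
    right_distrib := fun x y z => by simp [mul_def]
    zero_mul := fun x => by simp [mul_def]
    mul_zero := fun x => by simp [mul_def]
    mul_assoc := fun x y z => mulLin_assoc α x y z
    one_mul := fun x => by
      have h : mulLin α 1 = LinearMap.id := (basis α).ext fun g => by
        simp [one_def, mulLin_basis, α.val_one_left g, smul_smul]
      simp [mul_def, h]
    mul_one := fun x => by
      have h : (mulLin α).flip 1 = LinearMap.id := (basis α).ext fun g => by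
        simp [one_def, mulLin_basis, α.val_one_right g, smul_smul]
      exact LinearMap.congr_fun h x }

instance : Algebra R (TwistedGroupAlgebra α) :=
  Algebra.ofModule (fun r x y => by simp [mul_def]) (fun r x y => by simp [mul_def])

end TwistedGroupAlgebra

/-- `G ∼_R H`: there is a group isomorphism `ψ : H²(G, Rˣ) → H²(H, Rˣ)` such that `R^α G` and
`R^β H` are isomorphic `R`-algebras whenever `ψ [α] = [β]`. -/
def TwistIsomorphic (R G H : Type) [CommRing R] [Group G] [Group H] : Prop :=
  ∃ ψ : SecondCohomology R G ≃+ SecondCohomology R H,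
    ∀ (α : TwoCocycle R G) (β : TwoCocycle R H),
      ψ α.cohomologyClass = β.cohomologyClass →
        Nonempty (TwistedGroupAlgebra α ≃ₐ[R] TwistedGroupAlgebra β)

/-- A group `G` of order `p ^ n` has generalized corank `s` if
`|H²(G, ℂˣ)| = p ^ ((n - 1) (n - 2) / 2 + 1 - s)`. The exponent is an integer, and the division
by two is exact. -/
def HasGeneralizedCorank (p n : ℕ) (G : Type) [Group G] (s : ℤ) : Prop :=
  (Nat.card (SecondCohomology ℂ G) : ℚ) =
    (p : ℚ) ^ (((n : ℤ) - 1) * ((n : ℤ) - 2) / 2 + 1 - s)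

end

open Subgroup
open scoped commutatorElement

/-! Write M(G) for H²(G, ℂˣ). A twist isomorphism preserves |M(G)| and also |G : G'|, since the
latter counts the algebra homomorphisms to ℂ of the untwisted group algebra. For |G| = p^(n+1), s ≤
1 means that |M(G)| ≥ p^(n choose 2). So the content is `nonempty_mulEquiv_of_card_schurMultiplier`:
with so large a multiplier, |G| and |G'| > 1 determine G. The converse is transport of structure.

The main tool is the pairing F(g, z) = α(g, z) / α(z, g) for central z, which is the commutator of
lifts in the central extension of G by ℂˣ attached to α. It gives a homomorphism M(G) → Hom(G, ℂˣ)
whose kernel is inflated from G/⟨z⟩ (`ker_pairingMap_le`). If z has order p and lies in G',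
inflation kills an element of order p (`exists_mem_ker_inflation`), whence p|M(G)| ≤ |M(G/⟨z⟩)| ·
|image|. Induction, with abelian groups bounded separately, yields p^k |M(G)| ≤ p^((n choose 2) + 1)
when |G'| = p^(k+1). Hence k ≤ 1.

For k = 0 there is a nontrivial pairing character χ. By the Hall–Witt identity in the extension
(`commPairing_jacobi`) its kernel is abelian, and elements outside the kernel have order p. This
pins down G: an elementary abelian group times the nonabelian group of order p³ and exponent p, or
times the dihedral group of order 8 if p = 2 (`IsHeisenbergType`).

For k = 1 every estimate is an equality, for each central z of order p in G': all characters are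
pairings with z, and G/⟨z⟩ is extremal for k = 0, which excludes p = 2. It follows that G has class
two and exponent p, and is generated by an elementary abelian A and an element a for which x ↦ [a,
x] on A has kernel and image G' (`IsRankTwoType`). Linear algebra over 𝔽_p then gives uniqueness. -/

/-- The group of multiplicative 2-cocycles with values in `ℂˣ`, for the trivial action. -/
def schurCocycles (G : Type) [Group G] : Subgroup (G → G → ℂˣ) where
  carrier := {α | ∀ g h j, α (g * h) j * α g h = α h j * α g (h * j)}
  one_mem' := by simp
  mul_mem' := by
    intro α β hα hβ g h j
    simp only [Pi.mul_apply]
    rw [mul_mul_mul_comm, hα, hβ, mul_mul_mul_comm]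
  inv_mem' := by
    intro α hα g h j
    simp only [Pi.inv_apply, ← mul_inv, hα g h j]

/-- The coboundary homomorphism from 1-cochains to 2-cochains. -/
def schurCoboundary (G : Type) [Group G] : (G → ℂˣ) →* (G → G → ℂˣ) where
  toFun l := fun g h => l h * (l (g * h))⁻¹ * l g
  map_one' := by ext; simp
  map_mul' l m := by
    funext g h
    simp only [Pi.mul_apply, mul_inv]
    simp only [mul_comm, mul_left_comm, mul_assoc]

/-- The Schur multiplier `H²(G, ℂˣ)`, written multiplicatively. -/
abbrev SchurMultiplier (G : Type) [Group G] : Type :=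
  schurCocycles G ⧸ ((schurCoboundary G).range.subgroupOf (schurCocycles G))

/-! ### The central extension of a group attached to a cocycle -/

section Cocycle

variable {G : Type} [Group G]

theorem schurCocycles_apply (α : schurCocycles G) (g h j : G) :
    α.1 (g * h) j * α.1 g h = α.1 h j * α.1 g (h * j) := α.2 g h j

theorem schurCocycles_one_left (α : schurCocycles G) (g : G) : α.1 1 g = α.1 1 1 := by
  have := α.2 1 1 g
  simp only [mul_one, one_mul] at this
  exact (mul_left_cancel this).symm

theorem schurCocycles_one_right (α : schurCocycles G) (g : G) : α.1 g 1 = α.1 1 1 := by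
  have := α.2 g 1 1
  simp only [mul_one] at this
  exact mul_right_cancel (this.trans (mul_comm _ _) |>.trans (mul_comm _ _))

/-- The central extension of `G` by `ℂˣ` attached to a 2-cocycle. -/
@[ext]
structure CocycleExtension (α : schurCocycles G) where
  /-- the component in the quotient group -/
  base : G
  /-- the scalar component -/
  scalar : ℂˣ

namespace CocycleExtension

variable (α : schurCocycles G)

instance : Mul (CocycleExtension α) :=
  ⟨fun x y => ⟨x.base * y.base, x.scalar * y.scalar * α.1 x.base y.base⟩⟩

/-- Cocycles are not assumed normalised; this accounts for the factor α(1, 1)⁻¹ here, in inverses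
and in `incl`. -/
instance : One (CocycleExtension α) := ⟨⟨1, (α.1 1 1)⁻¹⟩⟩

instance : Inv (CocycleExtension α) :=
  ⟨fun x => ⟨x.base⁻¹, x.scalar⁻¹ * (α.1 x.base⁻¹ x.base)⁻¹ * (α.1 1 1)⁻¹⟩⟩

variable {α}

@[simp] theorem mul_base (x y : CocycleExtension α) : (x * y).base = x.base * y.base := rfl
@[simp] theorem mul_scalar (x y : CocycleExtension α) :
    (x * y).scalar = x.scalar * y.scalar * α.1 x.base y.base := rfl
@[simp] theorem one_base : (1 : CocycleExtension α).base = 1 := rfl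
@[simp] theorem one_scalar : (1 : CocycleExtension α).scalar = (α.1 1 1)⁻¹ := rfl
@[simp] theorem inv_base (x : CocycleExtension α) : x⁻¹.base = x.base⁻¹ := rfl
@[simp] theorem inv_scalar (x : CocycleExtension α) :
    x⁻¹.scalar = x.scalar⁻¹ * (α.1 x.base⁻¹ x.base)⁻¹ * (α.1 1 1)⁻¹ := rfl

instance : Group (CocycleExtension α) :=
  Group.ofLeftAxioms
    (fun x y z => by
      ext1
      · simp [mul_assoc]
      · have := schurCocycles_apply α x.base y.base z.base
        simp only [mul_scalar, mul_base]
        calc _ = x.scalar * y.scalar * z.scalar *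
              (α.1 (x.base * y.base) z.base * α.1 x.base y.base) := by
              simp only [mul_comm, mul_left_comm, mul_assoc]
          _ = _ := by rw [this]; simp only [mul_comm, mul_left_comm, mul_assoc])
    (fun x => by
      ext1
      · simp
      · simp [schurCocycles_one_left])
    (fun x => by
      ext1
      · simp
      · simp only [mul_scalar, inv_scalar, inv_base, one_scalar]
        calc _ = (x.scalar⁻¹ * x.scalar) * ((α.1 x.base⁻¹ x.base)⁻¹ * α.1 x.base⁻¹ x.base) *
              (α.1 1 1)⁻¹ := by simp only [mul_comm, mul_left_comm, mul_assoc]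
          _ = _ := by simp)

/-- The projection onto the quotient group. -/
def proj : CocycleExtension α →* G where
  toFun := base
  map_one' := rfl
  map_mul' _ _ := rfl

@[simp] theorem proj_apply (x : CocycleExtension α) : proj x = x.base := rfl

/-- The inclusion of the scalars. -/
def incl : ℂˣ →* CocycleExtension α where
  toFun c := ⟨1, c * (α.1 1 1)⁻¹⟩
  map_one' := by ext1 <;> simp
  map_mul' c d := by
    ext1
    · simp
    · simp [mul_comm, mul_left_comm, mul_assoc]

@[simp] theorem incl_base (c : ℂˣ) : (incl c : CocycleExtension α).base = 1 := rfl
@[simp] theorem incl_scalar (c : ℂˣ) :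
    (incl c : CocycleExtension α).scalar = c * (α.1 1 1)⁻¹ := rfl

theorem incl_mul (c : ℂˣ) (x : CocycleExtension α) : incl c * x = ⟨x.base, c * x.scalar⟩ := by
  ext1
  · simp
  · simp [schurCocycles_one_left, mul_comm, mul_left_comm]

theorem mul_incl (c : ℂˣ) (x : CocycleExtension α) : x * incl c = ⟨x.base, c * x.scalar⟩ := by
  ext1
  · simp
  · simp [schurCocycles_one_right, mul_comm, mul_left_comm]

theorem incl_comm (c : ℂˣ) (x : CocycleExtension α) : incl c * x = x * incl c := by
  rw [incl_mul, mul_incl]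

theorem incl_injective : Function.Injective (incl : ℂˣ →* CocycleExtension α) := by
  intro c d h
  have := congrArg scalar h
  simpa using this

theorem exists_incl_mul_of_base_eq {x y : CocycleExtension α} (h : x.base = y.base) :
    ∃ c, x = incl c * y := by
  refine ⟨x.scalar * y.scalar⁻¹, ?_⟩
  rw [incl_mul]
  ext1 <;> simp [h]

/-- The standard set-theoretic section. -/
def lift (g : G) : CocycleExtension α := ⟨g, 1⟩

@[simp] theorem lift_base (g : G) : (lift g : CocycleExtension α).base = g := rfl

end CocycleExtension

/-- The commutator pairing of a 2-cocycle, meaningful for commuting arguments. -/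
def commPairing {G : Type} (α : G → G → ℂˣ) (g h : G) : ℂˣ := α g h * (α h g)⁻¹

open CocycleExtension

variable {α : schurCocycles G}

/-- Scalars are central, so the commutator depends only on the bases. This translates between values
of α and commutator calculus in the extension. -/
theorem incl_commPairing {x y : CocycleExtension α} (h : x.base * y.base = y.base * x.base) :
    ⁅x, y⁆ = incl (commPairing α.1 x.base y.base) := by
  rw [commutatorElement_def, mul_inv_eq_iff_eq_mul, mul_inv_eq_iff_eq_mul, mul_assoc, incl_mul]
  ext1
  · simpa using h
  · simp [commPairing, mul_comm, mul_left_comm, mul_assoc]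

end Cocycle

open CocycleExtension

/-! ### Commutator identities of Hall–Witt type -/

section GroupIdentities

variable {E : Type*} [Group E]

/-- Each of x, y, w is moved once past the commutator of the other two, until the starting word
reappears multiplied by abc. The commutators A, B, C are only central up to the central factors a,
b, c, because in the application they are lifts of central elements. -/
theorem jacobi_of_central {x y w A B C a b c : E} (hA : x * y = A * (y * x))
    (hB : y * w = B * (w * y)) (hC : w * x = C * (x * w)) (ha : w * A = a * (A * w))
    (hb : x * B = b * (B * x)) (hc : y * C = c * (C * y)) (za : ∀ e, a * e = e * a)
    (zb : ∀ e, b * e = e * b) (zc : ∀ e, c * e = e * c) (AB : A * B = B * A) (AC : A * C = C * A)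
    (BC : B * C = C * B) : a * b * c = 1 := by
  have h1 : C * (A * (y * (x * w))) = a * (b * (c * (C * (A * (y * (x * w)))))) := by
    calc C * (A * (y * (x * w))) = C * ((A * (y * x)) * w) := by group
      _ = C * ((x * (B * (w * y)))) := by rw [← hA, mul_assoc x, hB]
      _ = C * (b * (B * x) * (w * y)) := by rw [← hb]; group
      _ = (C * b) * B * (x * (w * y)) := by group
      _ = b * (B * ((C * (x * w)) * y)) := by rw [← zb, mul_assoc b, ← BC]; group
      _ = b * (B * (w * (A * (y * x)))) := by rw [← hC, ← hA]; group
      _ = b * (B * (a * (A * w) * (y * x))) := by rw [← ha]; group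
      _ = b * ((B * a) * (A * (w * (y * x)))) := by group
      _ = (b * a) * (B * A * (w * (y * x))) := by rw [← za]; group
      _ = a * (b * (A * ((B * (w * y)) * x))) := by rw [← za, ← AB]; group
      _ = a * (b * (A * (y * (C * (x * w))))) := by rw [← hB, ← hC]; group
      _ = a * (b * (A * (c * (C * y) * (x * w)))) := by rw [← hc]; group
      _ = a * (b * ((A * c) * (C * (y * (x * w))))) := by group
      _ = a * (b * (c * (A * C * (y * (x * w))))) := by rw [← zc]; group
      _ = _ := by rw [AC]; group
  have h2 : (a * b * c) * (C * (A * (y * (x * w)))) = C * (A * (y * (x * w))) := by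
    rw [mul_assoc a, mul_assoc a, mul_assoc b]; exact h1.symm
  exact mul_eq_right.mp h2

/-- Moving c = [x, y] to the right through xy, and through c·yx, produces the same word PQxyc with
factors q and s. -/
theorem commutator_swap_of_central {x y c P Q q s : E} (hc : x * y = c * (y * x))
    (hP : c * x = P * (x * c)) (hQ : c * y = Q * (y * c)) (hq : x * Q = q * (Q * x))
    (hs : y * P = s * (P * y)) (zq : ∀ e, q * e = e * q) (zs : ∀ e, s * e = e * s)
    (PQ : P * Q = Q * P) (cP : c * P = P * c) (cQ : c * Q = Q * c) : q = s := by
  have h1 : c * (x * y) = q * (P * (Q * (x * (y * c)))) := by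
    calc c * (x * y) = (c * x) * y := by group
      _ = P * (x * (c * y)) := by rw [hP]; group
      _ = P * ((x * Q) * (y * c)) := by rw [hQ]; group
      _ = (P * q) * (Q * (x * (y * c))) := by rw [hq]; group
      _ = _ := by rw [← zq]; group
  have h2 : c * (x * y) = s * (P * (Q * (x * (y * c)))) := by
    calc c * (x * y) = c * ((c * y) * x) := by rw [hc]; group
      _ = c * (Q * (y * (c * x))) := by rw [hQ]; group
      _ = c * (Q * ((y * P) * (x * c))) := by rw [hP]; group
      _ = (c * Q) * s * (P * y * (x * c)) := by rw [hs]; group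
      _ = s * (c * Q * P * (y * (x * c))) := by rw [← zs]; group
      _ = s * (P * Q * ((c * (y * x)) * c)) := by
        rw [cQ, mul_assoc Q, cP, ← mul_assoc Q, ← PQ]; group
      _ = _ := by rw [← hc]; group
  exact mul_right_cancel (h1.symm.trans h2)

/-- Both xy and yx commute with B up to the same central factor [x, B][y, B], so their quotient
commutes with B exactly. -/
theorem commute_of_commutator_central {B x y : E} (hx : ⁅x, B⁆ ∈ center E)
    (hy : ⁅y, B⁆ ∈ center E) : Commute ⁅x, y⁆ B := by
  have hx' := Subgroup.mem_center_iff.mp hx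
  have hy' := Subgroup.mem_center_iff.mp hy
  have ex : x * B = ⁅x, B⁆ * (B * x) := by rw [commutatorElement_def]; group
  have ey : y * B = ⁅y, B⁆ * (B * y) := by rw [commutatorElement_def]; group
  have h1 : x * y * B = ⁅x, B⁆ * ⁅y, B⁆ * (B * (x * y)) := by
    calc x * y * B = x * (y * B) := by group
      _ = (x * ⁅y, B⁆) * (B * y) := by rw [ey]; group
      _ = ⁅y, B⁆ * ((x * B) * y) := by rw [hy']; group
      _ = ⁅y, B⁆ * ⁅x, B⁆ * (B * (x * y)) := by rw [ex]; group
      _ = _ := by rw [← hy' ⁅x, B⁆]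
  have h2 : y * x * B = ⁅x, B⁆ * ⁅y, B⁆ * (B * (y * x)) := by
    calc y * x * B = y * (x * B) := by group
      _ = (y * ⁅x, B⁆) * (B * x) := by rw [ex]; group
      _ = ⁅x, B⁆ * ((y * B) * x) := by rw [hx']; group
      _ = ⁅x, B⁆ * ⁅y, B⁆ * (B * (y * x)) := by rw [ey]; group
  have h3 : ⁅x, y⁆ * (y * x) = x * y := by rw [commutatorElement_def]; group
  have zz : ∀ e, e * (⁅x, B⁆ * ⁅y, B⁆) = (⁅x, B⁆ * ⁅y, B⁆) * e :=
    Subgroup.mem_center_iff.mp (mul_mem hx hy)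
  have h4 : ⁅x, y⁆ * B * (y * x) * (⁅x, B⁆ * ⁅y, B⁆) =
      B * ⁅x, y⁆ * (y * x) * (⁅x, B⁆ * ⁅y, B⁆) := by
    calc _ = ⁅x, y⁆ * ((⁅x, B⁆ * ⁅y, B⁆) * (B * (y * x))) := by rw [← zz]; group
      _ = (⁅x, y⁆ * (y * x)) * B := by rw [← h2]; group
      _ = ⁅x, B⁆ * ⁅y, B⁆ * (B * (⁅x, y⁆ * (y * x))) := by rw [h3, h1]
      _ = _ := by rw [← zz]; group
  exact mul_right_cancel (mul_right_cancel h4)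

end GroupIdentities

/-! ### The commutator pairing of a cocycle -/

section Pairing

variable {G : Type} [Group G] {α : schurCocycles G}

theorem incl_mem_center (c : ℂˣ) : (incl c : CocycleExtension α) ∈ center (CocycleExtension α) :=
  Subgroup.mem_center_iff.mpr fun x => (incl_comm c x).symm

theorem commutator_base (x y : CocycleExtension α) : ⁅x, y⁆.base = ⁅x.base, y.base⁆ := by
  simp [commutatorElement_def]

theorem mul_eq_incl_commPairing {x y : CocycleExtension α}
    (h : x.base * y.base = y.base * x.base) :
    x * y = incl (commPairing α.1 x.base y.base) * (y * x) := by
  rw [← incl_commPairing h, commutatorElement_def]; group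

theorem commPairing_mul_left {g g' z : G} (h : g * z = z * g) (h' : g' * z = z * g') :
    commPairing α.1 (g * g') z = commPairing α.1 g z * commPairing α.1 g' z := by
  have hh : g * g' * z = z * (g * g') := by rw [mul_assoc, h', ← mul_assoc, h, mul_assoc]
  apply incl_injective (α := α)
  have e1 := mul_eq_incl_commPairing (α := α) (x := lift g * lift g') (y := lift z) hh
  have e2 := mul_eq_incl_commPairing (α := α) (x := lift g) (y := lift z) h
  have e3 := mul_eq_incl_commPairing (α := α) (x := lift g') (y := lift z) h'
  simp only [mul_base, lift_base] at e1 e2 e3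
  apply mul_right_cancel (b := lift z * (lift g * lift g'))
  rw [map_mul]
  calc _ = lift g * lift g' * lift z := e1.symm
    _ = (lift g * incl (commPairing α.1 g' z)) * (lift z * lift g') := by
      rw [mul_assoc, e3, ← mul_assoc]
    _ = incl (commPairing α.1 g' z) * ((lift g * lift z) * lift g') := by rw [← incl_comm]; group
    _ = (incl (commPairing α.1 g' z) * incl (commPairing α.1 g z)) *
        (lift z * (lift g * lift g')) := by rw [e2]; group
    _ = _ := by rw [incl_comm]

theorem commPairing_swap {G : Type} (α : G → G → ℂˣ) (g h : G) :
    commPairing α h g = (commPairing α g h)⁻¹ := by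
  simp [commPairing]

theorem commPairing_mul_right {g z z' : G} (h : g * z = z * g) (h' : g * z' = z' * g) :
    commPairing α.1 g (z * z') = commPairing α.1 g z * commPairing α.1 g z' := by
  rw [commPairing_swap _ (z * z'), commPairing_mul_left h.symm h'.symm, commPairing_swap _ z,
    commPairing_swap _ z', mul_inv]

theorem commPairing_one_right (g : G) : commPairing α.1 g 1 = 1 := by
  simp [commPairing, schurCocycles_one_left, schurCocycles_one_right]

/-- Any lift of x^k may be used to compute the pairing, in particular the k-th power of a lift of x.
-/
theorem commPairing_self_pow (x : G) (k : ℕ) : commPairing α.1 x (x ^ k) = 1 := by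
  have hb : ((lift x : CocycleExtension α) ^ k).base = x ^ k := map_pow proj (lift x) k
  have h : x * x ^ k = x ^ k * x := (Commute.self_pow x k).eq
  apply incl_injective (α := α)
  have := incl_commPairing (α := α) (x := lift x) (y := lift x ^ k) (by rw [hb]; exact h)
  rw [hb, lift_base] at this
  rw [← this, map_one, commutatorElement_eq_one_iff_commute]
  exact Commute.self_pow _ _

theorem commPairing_zpow_right {g z : G} (h : g * z = z * g) (k : ℤ) :
    commPairing α.1 g (z ^ k) = commPairing α.1 g z ^ k := by
  have key : ∀ k : ℕ, commPairing α.1 g (z ^ k) = commPairing α.1 g z ^ k := by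
    intro k
    induction k with
    | zero => simp [commPairing_one_right]
    | succ k ih =>
      rw [pow_succ, commPairing_mul_right ((show Commute g z from h).pow_right k) h, ih, pow_succ]
  have hinv : ∀ u : G, g * u = u * g → commPairing α.1 g u⁻¹ = (commPairing α.1 g u)⁻¹ := by
    intro u hu
    rw [eq_inv_iff_mul_eq_one, ← commPairing_mul_right (show Commute g u from hu).inv_right hu,
      inv_mul_cancel, commPairing_one_right]
  cases k with
  | ofNat k => simpa using key k
  | negSucc k =>
    rw [zpow_negSucc, zpow_negSucc, hinv _ ((show Commute g z from h).pow_right _), key]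

/-- The Hall–Witt identity for lifts. It expresses the pairing of w with [x, y] through pairings of
x and y, and so limits which characters can occur. -/
theorem commPairing_jacobi {x y w : G} (hA : ⁅x, y⁆ ∈ center G) (hB : ⁅y, w⁆ ∈ center G)
    (hC : ⁅w, x⁆ ∈ center G) :
    commPairing α.1 w ⁅x, y⁆ * commPairing α.1 x ⁅y, w⁆ * commPairing α.1 y ⁅w, x⁆ = 1 := by
  have key : ∀ (e f : CocycleExtension α), f.base ∈ center G →
      ⁅e, f⁆ ∈ center (CocycleExtension α) := fun e f hf => by
    rw [incl_commPairing (Subgroup.mem_center_iff.mp hf _)]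
    exact incl_mem_center _
  have com : ∀ u v : G, (lift u : CocycleExtension α) * lift v =
      ⁅(lift u : CocycleExtension α), (lift v : CocycleExtension α)⁆ * (lift v * lift u) := by
    intro u v; rw [commutatorElement_def]; group
  have act : ∀ (u : G) (f : CocycleExtension α), f.base ∈ center G →
      lift u * f = incl (commPairing α.1 u f.base) * (f * lift u) := fun u f hf =>
    mul_eq_incl_commPairing (Subgroup.mem_center_iff.mp hf _)
  have bb : ∀ u v : G, ⁅(lift u : CocycleExtension α), (lift v : CocycleExtension α)⁆.base
      = ⁅u, v⁆ := fun u v => commutator_base _ _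
  have cc : ∀ (u v : G) (f : CocycleExtension α), f.base ∈ center G →
      ⁅(lift u : CocycleExtension α), (lift v : CocycleExtension α)⁆ * f =
      f * ⁅(lift u : CocycleExtension α), (lift v : CocycleExtension α)⁆ := fun u v f hf =>
    (commute_of_commutator_central (key _ f hf) (key _ f hf)).eq
  have hA' := (bb x y).symm ▸ hA
  have hB' := (bb y w).symm ▸ hB
  have hC' := (bb w x).symm ▸ hC
  have := jacobi_of_central (com x y) (com y w) (com w x) (act w _ hA') (act x _ hB')
    (act y _ hC') (incl_comm _) (incl_comm _) (incl_comm _) (cc _ _ _ hB')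
    (cc _ _ _ hC') (cc _ _ _ hC')
  rw [bb, bb, bb] at this
  apply incl_injective (α := α)
  rw [map_mul, map_mul, map_one, this]

/-- The analogue of the previous identity for groups not yet known to be of class two; its purpose
is to exclude class three. -/
theorem commPairing_commutator_swap {x y : G} (hx : ⁅⁅x, y⁆, x⁆ ∈ center G)
    (hy : ⁅⁅x, y⁆, y⁆ ∈ center G) :
    commPairing α.1 x ⁅⁅x, y⁆, y⁆ = commPairing α.1 y ⁅⁅x, y⁆, x⁆ := by
  have key : ∀ (e f : CocycleExtension α), f.base ∈ center G →
      ⁅e, f⁆ ∈ center (CocycleExtension α) := fun e f hf => by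
    rw [incl_commPairing (Subgroup.mem_center_iff.mp hf _)]
    exact incl_mem_center _
  have com : ∀ u v : CocycleExtension α, u * v = ⁅u, v⁆ * (v * u) := by
    intro u v; rw [commutatorElement_def]; group
  have act : ∀ (u : G) (f : CocycleExtension α), f.base ∈ center G →
      lift u * f = incl (commPairing α.1 u f.base) * (f * lift u) := fun u f hf =>
    mul_eq_incl_commPairing (Subgroup.mem_center_iff.mp hf _)
  have cc : ∀ (u v : CocycleExtension α) (f : CocycleExtension α), f.base ∈ center G →
      ⁅u, v⁆ * f = f * ⁅u, v⁆ := fun u v f hf =>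
    (commute_of_commutator_central (key _ f hf) (key _ f hf)).eq
  have bx : ⁅⁅(lift x : CocycleExtension α), (lift y : CocycleExtension α)⁆,
      (lift x : CocycleExtension α)⁆.base = ⁅⁅x, y⁆, x⁆ := by
    rw [commutator_base, commutator_base]; rfl
  have by' : ⁅⁅(lift x : CocycleExtension α), (lift y : CocycleExtension α)⁆,
      (lift y : CocycleExtension α)⁆.base = ⁅⁅x, y⁆, y⁆ := by
    rw [commutator_base, commutator_base]; rfl
  have hx' := bx.symm ▸ hx
  have hy' := by'.symm ▸ hy
  have := commutator_swap_of_central (com (lift x) (lift y)) (com _ (lift x)) (com _ (lift y))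
    (act x _ hy') (act y _ hx') (incl_comm _) (incl_comm _) (cc _ _ _ hy') (cc _ _ _ hx')
    (cc _ _ _ hy')
  rw [bx, by'] at this
  exact incl_injective this

end Pairing

/-! ### Pullback and inflation of cocycles -/

section Functoriality

variable {G H : Type} [Group G] [Group H]

/-- Pullback of cocycles along a group homomorphism. -/
def schurComap (f : G →* H) : schurCocycles H →* schurCocycles G where
  toFun α := ⟨fun g h => α.1 (f g) (f h), fun g h j => by
    simpa using schurCocycles_apply α (f g) (f h) (f j)⟩
  map_one' := rfl
  map_mul' _ _ := rfl

@[simp] theorem schurComap_apply (f : G →* H) (α : schurCocycles H) (g h : G) :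
    (schurComap f α).1 g h = α.1 (f g) (f h) := rfl

/-- Coboundaries, as a subgroup of the cocycles. -/
abbrev schurBoundaries (G : Type) [Group G] : Subgroup (schurCocycles G) :=
  (schurCoboundary G).range.subgroupOf (schurCocycles G)

theorem mem_schurBoundaries {α : schurCocycles G} :
    α ∈ schurBoundaries G ↔ ∃ l : G → ℂˣ, ∀ g h, l h * (l (g * h))⁻¹ * l g = α.1 g h := by
  rw [Subgroup.mem_subgroupOf, MonoidHom.mem_range]
  refine exists_congr fun l => ⟨fun h g h' => ?_, fun h => ?_⟩
  · rw [← h]; rfl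
  · funext g h'; exact h g h'

/-- Pullback on Schur multipliers. -/
def schurMap (f : G →* H) : SchurMultiplier H →* SchurMultiplier G :=
  QuotientGroup.map _ _ (schurComap f) fun α hα => by
    obtain ⟨l, hl⟩ := mem_schurBoundaries.mp hα
    exact mem_schurBoundaries.mpr ⟨fun g => l (f g), fun g h => by simpa using hl (f g) (f h)⟩

theorem schurMap_mk (f : G →* H) (α : schurCocycles H) :
    schurMap f (QuotientGroup.mk α) = QuotientGroup.mk (schurComap f α) := rfl

theorem schurCoboundary_mem_cocycles (l : G → ℂˣ) : schurCoboundary G l ∈ schurCocycles G := by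
  intro g h j
  change l j * (l (g * h * j))⁻¹ * l (g * h) * (l h * (l (g * h))⁻¹ * l g) =
    l j * (l (h * j))⁻¹ * l h * (l (h * j) * (l (g * (h * j)))⁻¹ * l g)
  rw [mul_assoc g h j]
  calc _ = l j * (l (g * (h * j)))⁻¹ * l h * l g * (l (g * h) * (l (g * h))⁻¹) := by
        simp only [mul_comm, mul_left_comm, mul_assoc]
    _ = l j * (l (g * (h * j)))⁻¹ * l h * l g * ((l (h * j))⁻¹ * l (h * j)) := by simp
    _ = _ := by simp only [mul_comm, mul_left_comm, mul_assoc]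

/-- Evaluating at chosen coset representatives does not change γ, so the cocycle identity passes to
the quotient. -/
theorem exists_schurComap_mk_eq {N : Subgroup G} [N.Normal] (γ : schurCocycles G)
    (hγ : ∀ g h, ∀ m ∈ N, ∀ n ∈ N, γ.1 (g * m) (h * n) = γ.1 g h) :
    ∃ β : schurCocycles (G ⧸ N), schurComap (QuotientGroup.mk' N) β = γ := by
  have key : ∀ g h : G, γ.1 (Quotient.out (g : G ⧸ N)) (Quotient.out (h : G ⧸ N)) = γ.1 g h := by
    intro g h
    obtain ⟨m, hm⟩ := QuotientGroup.mk_out_eq_mul N g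
    obtain ⟨n, hn⟩ := QuotientGroup.mk_out_eq_mul N h
    rw [hm, hn, hγ _ _ _ m.2 _ n.2]
  refine ⟨⟨fun q r => γ.1 q.out r.out, ?_⟩, ?_⟩
  · intro q r t
    induction q using QuotientGroup.induction_on
    induction r using QuotientGroup.induction_on
    induction t using QuotientGroup.induction_on
    simp only [← QuotientGroup.mk_mul, key]
    exact schurCocycles_apply γ _ _ _
  · ext g h
    exact congrArg _ (key g h)

theorem schurComap_injective {f : G →* H} (hf : Function.Surjective f) :
    Function.Injective (schurComap f) := by
  intro α β h
  apply Subtype.ext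
  funext x y
  obtain ⟨g, rfl⟩ := hf x
  obtain ⟨g', rfl⟩ := hf y
  exact congrFun (congrFun (congrArg Subtype.val h) g) g'

end Functoriality

/-! ### Pairing with a central element, and inflation from the quotient by it -/

section PairingMap

variable {G : Type} [Group G]

/-- For a central element `z`, the homomorphism sending a class `[α]` to the character
`g ↦ α(g, z) / α(z, g)`. -/
def pairingMap (z : G) (hz : z ∈ center G) : SchurMultiplier G →* (G →* ℂˣ) :=
  QuotientGroup.lift _
    { toFun := fun α => MonoidHom.mk' (fun g => commPairing α.1 g z) fun g g' =>
        commPairing_mul_left (Subgroup.mem_center_iff.mp hz g) (Subgroup.mem_center_iff.mp hz g')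
      map_one' := by ext; simp [commPairing]
      map_mul' := fun α β => by
        ext1 g
        simp [commPairing, mul_comm, mul_left_comm, mul_assoc] }
    fun α hα => by
      obtain ⟨l, hl⟩ := mem_schurBoundaries.mp hα
      ext g
      simp only [MonoidHom.coe_mk, OneHom.coe_mk, MonoidHom.mk'_apply, MonoidHom.one_apply]
      rw [commPairing, ← hl, ← hl, Subgroup.mem_center_iff.mp hz g]
      simp only [mul_inv, inv_inv]
      congr 1
      calc l z * (l (z * g))⁻¹ * l g * ((l g)⁻¹ * l (z * g) * (l z)⁻¹)
          = (l z * (l z)⁻¹) * (l g * (l g)⁻¹) * (l (z * g) * (l (z * g))⁻¹) := by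
            simp only [mul_comm, mul_left_comm, mul_assoc]
        _ = 1 := by simp

theorem pairingMap_mk (z : G) (hz : z ∈ center G) (α : schurCocycles G) (g : G) :
    pairingMap z hz (QuotientGroup.mk α) g = commPairing α.1 g z := rfl

theorem exists_commPairing_of_mem_range {z : G} {hz : z ∈ center G} {χ : G →* ℂˣ}
    (h : χ ∈ (pairingMap z hz).range) : ∃ α : schurCocycles G, ∀ g, χ g = commPairing α.1 g z := by
  obtain ⟨q, rfl⟩ := h
  obtain ⟨α, rfl⟩ := QuotientGroup.mk_surjective q
  exact ⟨α, fun g => rfl⟩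

/-- A coordinate function for a cyclic subgroup `⟨z⟩`: each `g` is a coset representative times
a power of `z`. -/
theorem exists_coset_coordinate {N : Subgroup G} {z : G} (hN : N = zpowers z) :
    ∃ k : G → ℤ, ∀ g : G, g = Quotient.out (g : G ⧸ N) * z ^ k g := by
  have : ∀ g : G, ∃ k : ℤ, g = Quotient.out (g : G ⧸ N) * z ^ k := by
    intro g
    obtain ⟨m, hm⟩ := QuotientGroup.mk_out_eq_mul N g
    have hmz : m.1 ∈ zpowers z := hN.le m.2
    obtain ⟨k, hk⟩ := Subgroup.mem_zpowers_iff.mp hmz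
    refine ⟨-k, ?_⟩
    rw [hm, ← hk]; simp
  exact ⟨fun g => (this g).choose, fun g => (this g).choose_spec⟩

/-- The integer coordinate is only meaningful modulo the order of z, hence the comparison of powers
rather than exponents. -/
theorem coset_coordinate_mul {N : Subgroup G} {z : G} (hN : N = zpowers z) {k : G → ℤ}
    (hk : ∀ g : G, g = Quotient.out (g : G ⧸ N) * z ^ k g) (g : G) (i : ℤ) :
    z ^ k (g * z ^ i) = z ^ (k g + i) := by
  have hq : ((g * z ^ i : G) : G ⧸ N) = g := by
    rw [eq_comm, QuotientGroup.eq, hN]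
    simp [Subgroup.mem_zpowers_iff]
  have h1 := hk (g * z ^ i)
  rw [hq] at h1
  rw [zpow_add]
  have h2 := congrArg (· * z ^ i) (hk g)
  exact mul_left_cancel (h1.symm.trans (h2.trans (mul_assoc _ _ _)))

theorem zpow_eq_zpow_of_orderOf_eq {E : Type*} [Group E] {z : G} {e : E}
    (h : e ^ orderOf z = 1) {i j : ℤ} (hij : z ^ i = z ^ j) : e ^ i = e ^ j := by
  rw [zpow_eq_zpow_iff_modEq] at hij
  rw [zpow_eq_zpow_iff_modEq]
  exact hij.of_dvd (by exact_mod_cast orderOf_dvd_of_pow_eq_one h)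

theorem exists_units_pow_eq (c : ℂˣ) {n : ℕ} (hn : n ≠ 0) : ∃ d : ℂˣ, d ^ n = c := by
  obtain ⟨d, hd⟩ := IsAlgClosed.exists_pow_nat_eq (c : ℂ) (Nat.pos_of_ne_zero hn)
  have hd0 : d ≠ 0 := by
    rintro rfl
    rw [zero_pow hn] at hd
    exact c.ne_zero hd.symm
  exact ⟨Units.mk0 d hd0, Units.ext (by simpa using hd)⟩

/-- A class with trivial pairing against `z` is inflated from `G ⧸ ⟨z⟩`. -/
theorem ker_pairingMap_le {N : Subgroup G} [N.Normal] {z : G} (hN : N = zpowers z)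
    (hz : z ∈ center G) (ho : orderOf z ≠ 0) :
    (pairingMap z hz).ker ≤ (schurMap (QuotientGroup.mk' N)).range := by
  intro q hq
  obtain ⟨α, rfl⟩ := QuotientGroup.mk_surjective q
  have hF : ∀ g, commPairing α.1 g z = 1 := fun g => by
    rw [← pairingMap_mk z hz α g, MonoidHom.mem_ker.mp hq]; rfl
  obtain ⟨k, hk⟩ := exists_coset_coordinate hN
  -- As ℂˣ is divisible, a lift of z can be rescaled so that its order divides that of z. Trivial
  -- pairing will make it central.
  obtain ⟨Z, hZb, hZo⟩ : ∃ Z : CocycleExtension α, Z.base = z ∧ Z ^ orderOf z = 1 := by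
    have hb : ((lift z : CocycleExtension α) ^ orderOf z).base = (1 : CocycleExtension α).base := by
      rw [← proj_apply, map_pow, proj_apply, lift_base, pow_orderOf_eq_one]; rfl
    obtain ⟨c, hc⟩ := exists_incl_mul_of_base_eq hb
    obtain ⟨d, hd⟩ := exists_units_pow_eq c⁻¹ ho
    refine ⟨incl d * lift z, by simp, ?_⟩
    rw [(show Commute (incl d : CocycleExtension α) (lift z) from incl_comm _ _).mul_pow, hc,
      ← map_pow, hd]
    simp
  have hZc : ∀ e : CocycleExtension α, e * Z = Z * e := by
    intro e
    have := mul_eq_incl_commPairing (x := e) (y := Z)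
      (by rw [hZb]; exact Subgroup.mem_center_iff.mp hz _)
    rwa [hZb, hF, map_one, one_mul] at this
  have hZi : ∀ (i : ℤ) (e : CocycleExtension α), e * Z ^ i = Z ^ i * e := fun i e =>
    (show Commute e Z from hZc e).zpow_right i
  -- This section is equivariant under ⟨z⟩, so its cocycle γ, cohomologous to α, is constant on
  -- cosets of N and descends.
  set S : G → CocycleExtension α := fun g => lift (Quotient.out (g : G ⧸ N)) * Z ^ k g with hS
  have hSb : ∀ g, (S g).base = g := by
    intro g
    have : (Z ^ k g).base = z ^ k g := by rw [← proj_apply, map_zpow, proj_apply, hZb]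
    rw [hS]; simp only [mul_base, lift_base, this]; exact (hk g).symm
  have hSm : ∀ (g : G) (i : ℤ), S (g * z ^ i) = S g * Z ^ i := by
    intro g i
    have hq : ((g * z ^ i : G) : G ⧸ N) = g := by
      rw [eq_comm, QuotientGroup.eq, hN]
      simp [Subgroup.mem_zpowers_iff]
    simp only [hS]
    rw [hq, mul_assoc, ← zpow_add, zpow_eq_zpow_of_orderOf_eq hZo (coset_coordinate_mul hN hk g i)]
  set γ : schurCocycles G := α * ⟨schurCoboundary G fun g => (S g).scalar,
    schurCoboundary_mem_cocycles _⟩ with hγ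
  have hγS : ∀ g h, S g * S h = incl (γ.1 g h) * S (g * h) := by
    intro g h
    rw [incl_mul]
    ext1
    · simp [hSb]
    · have : γ.1 g h = α.1 g h * ((S h).scalar * (S (g * h)).scalar⁻¹ * (S g).scalar) := rfl
      rw [this, mul_scalar, hSb, hSb]
      calc _ = α.1 g h * (S h).scalar * (S g).scalar * ((S (g * h)).scalar⁻¹ * (S (g * h)).scalar)
            := by rw [inv_mul_cancel, mul_one]; simp only [mul_comm, mul_assoc]
        _ = _ := by simp only [mul_comm, mul_left_comm, mul_assoc]
  obtain ⟨β, hβ⟩ := exists_schurComap_mk_eq (N := N) γ (by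
    intro g h m hm n hn
    rw [hN] at hm hn
    obtain ⟨i, rfl⟩ := Subgroup.mem_zpowers_iff.mp hm
    obtain ⟨j, rfl⟩ := Subgroup.mem_zpowers_iff.mp hn
    apply incl_injective (α := α)
    have e : g * z ^ i * (h * z ^ j) = g * h * z ^ (i + j) := by
      have : Commute (z ^ i) h :=
        ((show Commute h z from Subgroup.mem_center_iff.mp hz h).zpow_right i).symm
      rw [zpow_add, mul_assoc g, ← mul_assoc _ h, this.eq]; group
    have h1 := hγS (g * z ^ i) (h * z ^ j)
    rw [e, hSm, hSm, hSm] at h1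
    have h2 : S g * Z ^ i * (S h * Z ^ j) = S g * S h * Z ^ (i + j) := by
      rw [zpow_add, mul_assoc (S g), ← mul_assoc _ (S h), ← hZi]; group
    rw [h2, hγS, mul_assoc] at h1
    exact (mul_right_cancel h1).symm)
  refine ⟨QuotientGroup.mk β, ?_⟩
  rw [schurMap_mk, hβ, hγ, eq_comm, QuotientGroup.eq, inv_mul_cancel_left]
  exact mem_schurBoundaries.mpr ⟨_, fun _ _ => rfl⟩

/-- If `z` lies in the commutator subgroup, then inflation from `G ⧸ ⟨z⟩` has an element of prime
order in its kernel. -/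
theorem exists_mem_ker_inflation {N : Subgroup G} [N.Normal] {z : G} (hN : N = zpowers z)
    (hz : z ∈ center G) {p : ℕ} [Fact p.Prime] (ho : orderOf z = p) (hz' : z ∈ commutator G) :
    ∃ t ∈ (schurMap (QuotientGroup.mk' N)).ker, orderOf t = p := by
  obtain ⟨k, hk⟩ := exists_coset_coordinate hN
  obtain ⟨w, hw⟩ : ∃ w : ℂˣ, orderOf w = p := by
    have hp0 : p ≠ 0 := (Fact.out : p.Prime).ne_zero
    have h := Complex.isPrimitiveRoot_exp p hp0
    refine ⟨(h.isUnit hp0).unit, ?_⟩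
    rw [← orderOf_units, IsUnit.unit_spec]
    exact h.eq_orderOf.symm
  have hwz : w ^ orderOf z = 1 := by rw [ho, ← hw, pow_orderOf_eq_one]
  -- Multiplying the argument by z multiplies l by the primitive root w. Hence the coboundary of l
  -- is constant on cosets and descends to a class killed by inflation.
  set l : G → ℂˣ := fun g => w ^ k g with hl
  have hlm : ∀ (g : G) (i : ℤ), l (g * z ^ i) = l g * w ^ i := by
    intro g i
    simp only [hl]
    rw [zpow_eq_zpow_of_orderOf_eq hwz (coset_coordinate_mul hN hk g i), zpow_add]
  set γ : schurCocycles G := ⟨schurCoboundary G l, schurCoboundary_mem_cocycles _⟩ with hγ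
  have hγa : ∀ g h, γ.1 g h = l h * (l (g * h))⁻¹ * l g := fun _ _ => rfl
  obtain ⟨τ, hτ⟩ := exists_schurComap_mk_eq (N := N) γ (by
    intro g h m hm n hn
    rw [hN] at hm hn
    obtain ⟨i, rfl⟩ := Subgroup.mem_zpowers_iff.mp hm
    obtain ⟨j, rfl⟩ := Subgroup.mem_zpowers_iff.mp hn
    have e : g * z ^ i * (h * z ^ j) = g * h * z ^ (i + j) := by
      have : Commute (z ^ i) h :=
        ((show Commute h z from Subgroup.mem_center_iff.mp hz h).zpow_right i).symm
      rw [zpow_add, mul_assoc g, ← mul_assoc _ h, this.eq]; group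
    rw [hγa, hγa, e, hlm, hlm, hlm]
    calc l h * w ^ j * (l (g * h) * w ^ (i + j))⁻¹ * (l g * w ^ i)
        = l h * (l (g * h))⁻¹ * l g * ((w ^ (i + j))⁻¹ * (w ^ i * w ^ j)) := by
          simp only [mul_inv, mul_comm, mul_left_comm, mul_assoc]
      _ = _ := by rw [← zpow_add, inv_mul_cancel, mul_one])
  refine ⟨QuotientGroup.mk τ, ?_, ?_⟩
  · rw [MonoidHom.mem_ker, schurMap_mk, hτ, QuotientGroup.eq_one_iff]
    exact mem_schurBoundaries.mpr ⟨l, fun _ _ => rfl⟩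
  · apply orderOf_eq_prime
    · rw [← QuotientGroup.mk_pow]
      have : τ ^ p = 1 := by
        apply schurComap_injective (QuotientGroup.mk'_surjective N)
        rw [map_pow, hτ, map_one]
        have hl1 : l ^ p = 1 := by
          funext g
          simp only [hl, Pi.pow_apply, Pi.one_apply]
          rw [← zpow_natCast, ← zpow_mul, mul_comm, zpow_mul, zpow_natCast, ← hw,
            pow_orderOf_eq_one, one_zpow]
        apply Subtype.ext
        change (schurCoboundary G l) ^ p = 1
        rw [← map_pow, hl1, map_one]
      rw [this]; rfl
    · intro h1
      rw [QuotientGroup.eq_one_iff] at h1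
      obtain ⟨μ, hμ⟩ := mem_schurBoundaries.mp h1
      have hμ' : ∀ g h : G, μ (h : G ⧸ N) * (μ ((g * h : G) : G ⧸ N))⁻¹ * μ (g : G ⧸ N) =
          l h * (l (g * h))⁻¹ * l g := by
        intro g h
        rw [QuotientGroup.mk_mul, hμ, ← hγa, ← hτ]; rfl
      -- If the descended cocycle were the coboundary of μ, then l/μ would be a character of G with
      -- value w ≠ 1 at z, although characters vanish on G'.
      let χ : G →* ℂˣ := MonoidHom.mk' (fun g => l g * (μ (g : G ⧸ N))⁻¹) (by
        intro g h
        have h2 : l h * l g * μ ((g * h : G) : G ⧸ N) = μ h * μ g * l (g * h) := by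
          have e := hμ' g h
          rw [mul_right_comm, mul_right_comm (l h), mul_inv_eq_iff_eq_mul, mul_right_comm,
            eq_mul_inv_iff_mul_eq] at e
          exact e.symm
        have h3 : l (g * h) = l h * l g * μ ((g * h : G) : G ⧸ N) * (μ h * μ g)⁻¹ := by
          rw [h2, mul_comm (μ h * μ g), mul_inv_cancel_right]
        rw [h3, mul_inv]
        calc _ = l h * l g * ((μ (h : G ⧸ N))⁻¹ * (μ (g : G ⧸ N))⁻¹) *
              (μ ((g * h : G) : G ⧸ N) * (μ ((g * h : G) : G ⧸ N))⁻¹) := by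
              simp only [mul_comm, mul_left_comm, mul_assoc]
          _ = _ := by
              rw [mul_inv_cancel, mul_one]; simp only [mul_comm, mul_left_comm, mul_assoc])
      have hχz : χ z = 1 := Abelianization.commutator_subset_ker χ hz'
      have hχ1 : l 1 * (μ ((1 : G) : G ⧸ N))⁻¹ = 1 := map_one χ
      have hzq : ((z : G) : G ⧸ N) = ((1 : G) : G ⧸ N) := by
        rw [eq_comm, QuotientGroup.eq, hN]; simp
      have hlz : l z = l 1 * w := by simpa using hlm 1 1
      have : l z * (μ (z : G ⧸ N))⁻¹ = 1 := hχz
      rw [hzq, hlz, mul_right_comm, hχ1, one_mul] at this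
      rw [this, orderOf_one] at hw
      exact (Fact.out : p.Prime).one_lt.ne hw

theorem finite_characters (G : Type) [Group G] [Finite G] : Finite (G →* ℂˣ) := by
  have : Finite (Abelianization G →* ℂˣ) := by
    apply Nat.finite_of_card_ne_zero
    rw [CommGroup.card_monoidHom_of_hasEnoughRootsOfUnity]
    exact Nat.card_pos.ne'
  exact Finite.of_equiv _ (Abelianization.lift (G := G) (A := ℂˣ)).symm

theorem card_schurMultiplier_le [Finite G] {N : Subgroup G} [N.Normal] {z : G}
    (hN : N = zpowers z) (hz : z ∈ center G) [Finite (SchurMultiplier (G ⧸ N))] :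
    Finite (SchurMultiplier G) ∧ Nat.card (SchurMultiplier G) ≤
      Nat.card (schurMap (QuotientGroup.mk' N)).range * Nat.card (pairingMap z hz).range := by
  have := finite_characters G
  have hle := ker_pairingMap_le hN hz (orderOf_pos z).ne'
  have : Finite (schurMap (QuotientGroup.mk' N)).range :=
    Finite.of_surjective _ (MonoidHom.rangeRestrict_surjective _)
  have hf : Finite (pairingMap z hz).ker :=
    Finite.of_injective _ (Subgroup.inclusion_injective hle)
  have hc : Nat.card (SchurMultiplier G) =
      Nat.card (pairingMap z hz).ker * Nat.card (pairingMap z hz).range := by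
    rw [← Subgroup.index_ker, Subgroup.card_mul_index]
  have h1 : Nat.card (pairingMap z hz).ker ≤ Nat.card (schurMap (QuotientGroup.mk' N)).range :=
    Nat.card_le_card_of_injective _ (Subgroup.inclusion_injective hle)
  refine ⟨Nat.finite_of_card_ne_zero ?_, hc ▸ Nat.mul_le_mul_right _ h1⟩
  rw [hc]
  exact mul_ne_zero Nat.card_pos.ne' Nat.card_pos.ne'

theorem card_schurMultiplier_le_mul [Finite G] {N : Subgroup G} [N.Normal] {z : G}
    (hN : N = zpowers z) (hz : z ∈ center G) [Finite (SchurMultiplier (G ⧸ N))] :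
    Nat.card (SchurMultiplier G) ≤
      Nat.card (SchurMultiplier (G ⧸ N)) * Nat.card (pairingMap z hz).range := by
  refine (card_schurMultiplier_le hN hz).2.trans (Nat.mul_le_mul_right _ ?_)
  exact Nat.card_le_card_of_surjective _ (MonoidHom.rangeRestrict_surjective _)

theorem prime_mul_card_schurMultiplier_le [Finite G] {N : Subgroup G} [N.Normal] {z : G}
    (hN : N = zpowers z) (hz : z ∈ center G) [Finite (SchurMultiplier (G ⧸ N))] {p : ℕ}
    [Fact p.Prime] (ho : orderOf z = p) (hz' : z ∈ commutator G) :
    p * Nat.card (SchurMultiplier G) ≤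
      Nat.card (SchurMultiplier (G ⧸ N)) * Nat.card (pairingMap z hz).range := by
  obtain ⟨t, ht, hto⟩ := exists_mem_ker_inflation hN hz ho hz'
  have h1 : p ≤ Nat.card (schurMap (QuotientGroup.mk' N)).ker := by
    rw [← hto, ← Nat.card_zpowers]
    exact Nat.card_le_card_of_injective _
      (Subgroup.inclusion_injective (Subgroup.zpowers_le.mpr ht))
  have hc : Nat.card (SchurMultiplier (G ⧸ N)) =
      Nat.card (schurMap (QuotientGroup.mk' N)).ker *
        Nat.card (schurMap (QuotientGroup.mk' N)).range := by
    rw [← Subgroup.index_ker, Subgroup.card_mul_index]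
  rw [hc, mul_assoc]
  exact Nat.mul_le_mul h1 (card_schurMultiplier_le hN hz).2

end PairingMap

/-! ### Counting and separating by characters -/

section Characters

variable {G : Type} [Group G] [Finite G]

theorem card_characters_le_index {K : Subgroup G} [K.Normal] (hK : commutator G ≤ K)
    (S : Subgroup (G →* ℂˣ)) (hS : ∀ χ ∈ S, ∀ g ∈ K, χ g = 1) : Nat.card S ≤ K.index := by
  let _ : CommGroup (G ⧸ K) :=
    { (inferInstance : Group (G ⧸ K)) with
      mul_comm := fun a b => by
        induction a using QuotientGroup.induction_on with | H a => ?_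
        induction b using QuotientGroup.induction_on with | H b => ?_
        rw [← QuotientGroup.mk_mul, ← QuotientGroup.mk_mul, QuotientGroup.eq]
        apply hK
        have : (a * b)⁻¹ * (b * a) = ⁅b⁻¹, a⁻¹⁆ := by rw [commutatorElement_def]; group
        rw [this]
        exact Subgroup.commutator_mem_commutator (mem_top _) (mem_top _) }
  have := finite_characters (G ⧸ K)
  rw [Subgroup.index, ← CommGroup.card_monoidHom_of_hasEnoughRootsOfUnity (G ⧸ K) ℂ]
  refine Nat.card_le_card_of_injective
    (fun χ : S => QuotientGroup.lift K χ.1 fun g hg => hS χ.1 χ.2 g hg) ?_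
  intro χ ψ h
  ext g
  have := DFunLike.congr_fun h (g : G ⧸ K)
  exact congrArg Units.val this

/-- The characters of the finite abelian group G/G' separate its elements. -/
theorem mem_commutator_of_characters {x : G} (h : ∀ χ : G →* ℂˣ, χ x = 1) :
    x ∈ commutator G := by
  by_contra hx
  have h1 : Abelianization.of x ≠ 1 := by
    intro h1
    exact hx ((QuotientGroup.eq_one_iff x).mp h1)
  obtain ⟨φ, hφ⟩ := CommGroup.exists_apply_ne_one_of_hasEnoughRootsOfUnity (Abelianization G) ℂ h1
  exact hφ (h (φ.comp Abelianization.of))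

end Characters

/-! ### p-groups, and the multiplier of an abelian p-group -/

section PGroup

variable {G : Type} [Group G] {p : ℕ} [hp : Fact p.Prime]

theorem mem_zpowers_of_orderOf_prime {z u : G} (ho : orderOf z = p) (hu : u ∈ zpowers z)
    (hu1 : u ≠ 1) : z ∈ zpowers u := by
  have hc : Nat.card (zpowers z) = p := by rw [Nat.card_zpowers, ho]
  have := mem_zpowers_of_prime_card (G := zpowers z) hc (g := ⟨u, hu⟩) (g' := ⟨z, mem_zpowers z⟩)
    (by simpa [Subtype.ext_iff] using hu1)
  obtain ⟨j, hj⟩ := Subgroup.mem_zpowers_iff.mp this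
  exact Subgroup.mem_zpowers_iff.mpr ⟨j, by simpa using congrArg Subtype.val hj⟩

/-- Under conjugation the number of fixed points on N is divisible by p, so there is one besides 1.
-/
theorem exists_mem_center_of_normal [Finite G] (hG : IsPGroup p G) {N : Subgroup G} [N.Normal]
    (hN : N ≠ ⊥) : ∃ z ∈ N, z ∈ center G ∧ orderOf z = p := by
  have hpN : p ∣ Nat.card N := by
    rcases (hG.to_subgroup N).card_eq_or_dvd with h | h
    · exact absurd (Subgroup.card_eq_one.mp h) hN
    · exact h
  have hG' : IsPGroup p (ConjAct G) := hG
  obtain ⟨b, hb, hb1⟩ := hG'.exists_fixed_point_of_prime_dvd_card_of_fixed_point N hpN (a := 1)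
    (fun g => smul_one g)
  have hbc : (b : G) ∈ center G := by
    rw [Subgroup.mem_center_iff]
    intro g
    have h := congrArg Subtype.val (hb (ConjAct.toConjAct g))
    rw [ConjAct.Subgroup.val_conj_smul, ConjAct.toConjAct_smul] at h
    exact mul_inv_eq_iff_eq_mul.mp h
  have hb1' : (b : G) ≠ 1 := fun h => hb1 (Subtype.ext h).symm
  have hd : p ∣ orderOf (b : G) := hG.dvd_orderOf hb1'
  refine ⟨(b : G) ^ (orderOf (b : G) / p), pow_mem b.2 _, pow_mem hbc _, ?_⟩
  exact orderOf_pow_orderOf_div (orderOf_pos _).ne' hd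

theorem eq_zpowers_of_card_prime {N : Subgroup G} (hN : Nat.card N = p) {z : G} (hz : z ∈ N)
    (ho : orderOf z = p) : N = zpowers z := by
  have : Finite N := Nat.finite_of_card_ne_zero (hN ▸ hp.out.ne_zero)
  refine (Subgroup.eq_of_le_of_card_ge (zpowers_le.mpr hz) ?_).symm
  rw [hN, Nat.card_zpowers, ho]

theorem card_quotient_zpowers [Finite G] {n : ℕ} (hG : Nat.card G = p ^ (n + 1)) {N : Subgroup G}
    {z : G} (hN : N = zpowers z) (ho : orderOf z = p) : Nat.card (G ⧸ N) = p ^ n := by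
  have h := Subgroup.card_mul_index N
  have h2 : Nat.card N = p := by rw [hN, Nat.card_zpowers, ho]
  rw [h2, hG, pow_succ', Subgroup.index] at h
  exact Nat.eq_of_mul_eq_mul_left hp.out.pos h

theorem quotient_comm_of_comm (hcomm : ∀ a b : G, a * b = b * a) (N : Subgroup G) [N.Normal]
    (a b : G ⧸ N) : a * b = b * a := by
  induction a using QuotientGroup.induction_on
  induction b using QuotientGroup.induction_on
  rw [← QuotientGroup.mk_mul, ← QuotientGroup.mk_mul, hcomm]

theorem index_le_of_lt [Finite G] {n m : ℕ} (hG : Nat.card G = p ^ n) {N K : Subgroup G}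
    (hNK : N < K) (hN : N.index = p ^ m) : K.index ≤ p ^ (m - 1) := by
  have hlt : K.index < N.index := Subgroup.index_strictAnti hNK
  obtain ⟨j, -, hj⟩ := (Nat.dvd_prime_pow hp.out).mp (hG ▸ K.index_dvd_card)
  rw [hj, hN] at hlt
  have := (Nat.pow_lt_pow_iff_right hp.out.one_lt).mp hlt
  rw [hj]
  exact Nat.pow_le_pow_right hp.out.pos (by omega)

theorem subsingleton_schurMultiplier (A : Type) [Group A] [Subsingleton A] :
    Subsingleton (SchurMultiplier A) := by
  refine ⟨fun a b => ?_⟩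
  have : ∀ q : SchurMultiplier A, q = 1 := by
    intro q
    obtain ⟨α, rfl⟩ := QuotientGroup.mk_surjective q
    rw [QuotientGroup.eq_one_iff]
    refine mem_schurBoundaries.mpr ⟨fun _ => α.1 1 1, fun g h => ?_⟩
    simp [Subsingleton.elim g 1, Subsingleton.elim h 1]
  rw [this a, this b]

theorem commutator_eq_bot_of_comm (hcomm : ∀ a b : G, a * b = b * a) : commutator G = ⊥ := by
  rw [eq_bot_iff, _root_.commutator_def, Subgroup.commutator_le]
  intro a _ b _
  rw [Subgroup.mem_bot, commutatorElement_eq_one_iff_mul_comm, hcomm]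

/-- The Schur multiplier of an abelian group of order `p ^ m` has order at most `p ^ (m choose 2)`,
and at most `p ^ (m - 1 choose 2)` if the group is not elementary. -/
theorem card_schurMultiplier_abelian (m : ℕ) : ∀ (A : Type) [Group A],
    (∀ a b : A, a * b = b * a) → Nat.card A = p ^ m → Finite (SchurMultiplier A) ∧
      Nat.card (SchurMultiplier A) ≤ p ^ m.choose 2 ∧
      ((∃ y : A, y ^ p ≠ 1) → Nat.card (SchurMultiplier A) ≤ p ^ (m - 1).choose 2) := by
  induction m with
  | zero =>
    intro A _ _ hA
    have hsub : Subsingleton A := (Nat.card_eq_one_iff_unique.mp (by simpa using hA)).1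
    have := subsingleton_schurMultiplier A
    refine ⟨inferInstance, by simp, fun ⟨y, hy⟩ => absurd (Subsingleton.elim _ _) hy⟩
  | succ m ih =>
    intro A _ hcomm hA
    have hfin : Finite A := Nat.finite_of_card_ne_zero (hA ▸ pow_ne_zero _ hp.out.ne_zero)
    have hcen : ∀ a : A, a ∈ center A := fun a => Subgroup.mem_center_iff.mpr fun g => hcomm g a
    have hnor : ∀ K : Subgroup A, K.Normal := fun K =>
      ⟨fun n hn g => by rw [hcomm g n, mul_inv_cancel_right]; exact hn⟩
    obtain ⟨z, ho⟩ := exists_prime_orderOf_dvd_card' p (G := A) (hA ▸ dvd_pow_self p (by omega))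
    obtain ⟨N, hN⟩ : ∃ N : Subgroup A, N = zpowers z := ⟨_, rfl⟩
    have := hnor N
    have hQ := card_quotient_zpowers hA hN ho
    obtain ⟨hfQ, hle, hle'⟩ := ih (A ⧸ N) (quotient_comm_of_comm hcomm N) hQ
    have hb := card_schurMultiplier_le_mul hN (hcen z)
    have hz1 : ∀ χ ∈ (pairingMap z (hcen z)).range, χ z = 1 := by
      intro χ hχ
      obtain ⟨α, hα⟩ := exists_commPairing_of_mem_range hχ
      rw [hα]
      simpa using commPairing_self_pow (α := α) z 1
    have hcom : commutator A = ⊥ := commutator_eq_bot_of_comm hcomm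
    refine ⟨(card_schurMultiplier_le hN (hcen z)).1, ?_, ?_⟩
    · have hr := card_characters_le_index (K := N) (hcom ▸ bot_le) (pairingMap z (hcen z)).range (by
        intro χ hχ g hg
        rw [hN] at hg
        obtain ⟨i, rfl⟩ := Subgroup.mem_zpowers_iff.mp hg
        rw [map_zpow, hz1 χ hχ, one_zpow])
      rw [Subgroup.index, hQ] at hr
      calc _ ≤ p ^ m.choose 2 * p ^ m := hb.trans (Nat.mul_le_mul hle hr)
        _ = p ^ (m + 1).choose 2 := by
          rw [← pow_add, Nat.choose_succ_succ' m 1, Nat.choose_one_right, add_comm]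
    · rintro ⟨y, hy⟩
      rw [Nat.add_sub_cancel]
      -- If A/⟨z⟩ is elementary, all p-th powers lie in ⟨z⟩ = ⟨y^p⟩ and the pairing with z will be
      -- trivial. Otherwise the sharper inductive bound applies to the quotient.
      by_cases hel : ∀ q : A ⧸ N, q ^ p = 1
      · have hmem : ∀ x : A, x ^ p ∈ zpowers z := fun x => by
          have := hel (x : A ⧸ N)
          rw [← QuotientGroup.mk_pow, QuotientGroup.eq_one_iff, hN] at this
          exact this
        have hzy := mem_zpowers_of_orderOf_prime ho (hmem y) hy
        obtain ⟨j, hj⟩ := Subgroup.mem_zpowers_iff.mp hzy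
        have htriv : (pairingMap z (hcen z)).range = ⊥ := by
          rw [eq_bot_iff]
          intro χ hχ
          obtain ⟨α, hα⟩ := exists_commPairing_of_mem_range hχ
          rw [Subgroup.mem_bot]
          ext1 x
          rw [hα, MonoidHom.one_apply]
          obtain ⟨i, hi⟩ := Subgroup.mem_zpowers_iff.mp
            ((zpowers_le.mpr hzy) (hmem x))
          have hyy : commPairing α.1 y y = 1 := by simpa using commPairing_self_pow (α := α) y 1
          -- Here x^p is a power of y^p, which pairs trivially with y. Bimultiplicativity then makes
          -- x pair trivially with y^p, hence with z.
          have h1 : commPairing α.1 y (x ^ p) = 1 := by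
            rw [← hi, ← zpow_natCast, commPairing_zpow_right (hcomm _ _),
              commPairing_zpow_right (hcomm _ _), hyy, one_zpow, one_zpow]
          rw [← zpow_natCast, commPairing_zpow_right (hcomm _ _), commPairing_swap, inv_zpow,
            inv_eq_one] at h1
          rw [← hj, ← zpow_natCast, commPairing_zpow_right (hcomm _ _),
            commPairing_zpow_right (hcomm _ _), h1, one_zpow]
        rw [htriv, Subgroup.card_bot, mul_one] at hb
        exact hb.trans hle
      · push Not at hel
        obtain ⟨q, hq⟩ := hel
        obtain ⟨v, rfl⟩ := QuotientGroup.mk_surjective q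
        have hvN : v ^ p ∉ N := fun h => hq (by
          rw [← QuotientGroup.mk_pow, QuotientGroup.eq_one_iff]; exact h)
        -- As z has order p, pairings with z kill v^p as well as z; this saves a factor p in the
        -- count of characters.
        have hlt : N < N ⊔ zpowers (v ^ p) := by
          refine lt_of_le_of_ne le_sup_left fun h => hvN ?_
          rw [h]; exact (le_sup_right : zpowers (v ^ p) ≤ _) (mem_zpowers _)
        have hi := index_le_of_lt hA hlt hQ
        have hr := card_characters_le_index (K := N ⊔ zpowers (v ^ p)) (hcom ▸ bot_le)
          (pairingMap z (hcen z)).range (by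
          intro χ hχ
          suffices h : N ⊔ zpowers (v ^ p) ≤ χ.ker from fun g hg => h hg
          rw [sup_le_iff, hN, zpowers_le, zpowers_le]
          refine ⟨hz1 χ hχ, ?_⟩
          rw [MonoidHom.mem_ker, map_pow]
          obtain ⟨α, hα⟩ := exists_commPairing_of_mem_range hχ
          rw [hα, ← zpow_natCast, ← commPairing_zpow_right (hcomm _ _), zpow_natCast, ← ho,
            pow_orderOf_eq_one, commPairing_one_right])
        have hm : m ≠ 0 := by
          rintro rfl
          have hsub : Subsingleton (A ⧸ N) :=
            (Nat.card_eq_one_iff_unique.mp (by simpa using hQ)).1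
          exact hq (Subsingleton.elim _ _)
        obtain ⟨m, rfl⟩ := Nat.exists_eq_succ_of_ne_zero hm
        calc _ ≤ p ^ m.choose 2 * p ^ m := hb.trans (Nat.mul_le_mul (hle' ⟨_, hq⟩) (hr.trans hi))
          _ = p ^ (m + 1).choose 2 := by
            rw [← pow_add, Nat.choose_succ_succ' m 1, Nat.choose_one_right, add_comm]

end PGroup

/-! ### Derived subgroups of quotients -/

section Commutator

variable {G : Type} [Group G]

theorem commutatorElement_mem_commutator (x y : G) : ⁅x, y⁆ ∈ commutator G :=
  Subgroup.commutator_mem_commutator (mem_top _) (mem_top _)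

theorem commutator_quotient_eq_map (N : Subgroup G) [N.Normal] :
    commutator (G ⧸ N) = (commutator G).map (QuotientGroup.mk' N) := by
  rw [_root_.commutator_def, _root_.commutator_def, Subgroup.map_commutator,
    Subgroup.map_top_of_surjective _ (QuotientGroup.mk'_surjective N)]

theorem normal_of_le_center {N : Subgroup G} (hN : N ≤ center G) : N.Normal :=
  ⟨fun n hn g => by
    rw [Subgroup.mem_center_iff.mp (hN hn) g, mul_inv_cancel_right]; exact hn⟩

theorem card_commutator_quotient {N : Subgroup G} [N.Normal] (hN : N ≤ commutator G) :
    Nat.card N * Nat.card (commutator (G ⧸ N)) = Nat.card (commutator G) := by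
  rw [commutator_quotient_eq_map, ← Subgroup.relIndex_ker, QuotientGroup.ker_mk',
    ← Subgroup.relIndex_bot_left N, Subgroup.relIndex_mul_relIndex _ _ _ bot_le hN,
    Subgroup.relIndex_bot_left]

theorem comm_of_commutator_eq_bot (h : commutator G = ⊥) (a b : G) : a * b = b * a := by
  rw [← commutatorElement_eq_one_iff_mul_comm, ← Subgroup.mem_bot, ← h]
  exact commutatorElement_mem_commutator a b

theorem quotient_commutator_comm (a b : G ⧸ commutator G) : a * b = b * a :=
  mul_comm (G := Abelianization G) a b

end Commutator

/-! ### Upper bounds for the multiplier of a nonabelian p-group -/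

section Bounds

variable {G : Type} [Group G] {p : ℕ} [hp : Fact p.Prime]

omit hp in
theorem pow_eq_one_of_mem_range_pairingMap {z : G} {hz : z ∈ center G} (ho : orderOf z = p)
    {χ : G →* ℂˣ} (h : χ ∈ (pairingMap z hz).range) (g : G) : χ g ^ p = 1 := by
  obtain ⟨α, hα⟩ := exists_commPairing_of_mem_range h
  rw [hα, ← zpow_natCast, ← commPairing_zpow_right (Subgroup.mem_center_iff.mp hz g), zpow_natCast,
    ← ho, pow_orderOf_eq_one, commPairing_one_right]

/-- The values of a pairing with `z` against the powers of `z`. -/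
theorem commPairing_eq_one_of_mem_zpowers {α : schurCocycles G} {g z u : G} (hz : z ∈ center G)
    (h : commPairing α.1 g z = 1) (hu : u ∈ zpowers z) : commPairing α.1 g u = 1 := by
  obtain ⟨i, rfl⟩ := Subgroup.mem_zpowers_iff.mp hu
  rw [commPairing_zpow_right (Subgroup.mem_center_iff.mp hz g), h, one_zpow]

variable {z : G} (hz : z ∈ center G) (ho : orderOf z = p) (hG' : commutator G = zpowers z)

include ho hG' in
-- By the Jacobi identity the pairing of any w with [x, y] is governed by the values at x and y, and
-- [x, y] generates G' = ⟨z⟩. So pairing characters are determined by two p-th roots of unity.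
theorem eq_one_of_mem_range_pairingMap {x y : G} (hxy : ⁅x, y⁆ ≠ 1) {χ : G →* ℂˣ}
    (hχ : χ ∈ (pairingMap z hz).range) (hx : χ x = 1) (hy : χ y = 1) : χ = 1 := by
  obtain ⟨α, hα⟩ := exists_commPairing_of_mem_range hχ
  have hmem : ∀ u v : G, ⁅u, v⁆ ∈ zpowers z := fun u v =>
    hG' ▸ commutatorElement_mem_commutator u v
  have hcen : ∀ u v : G, ⁅u, v⁆ ∈ center G := fun u v => zpowers_le.mpr hz (hmem u v)
  ext1 w
  have hj := commPairing_jacobi (α := α) (hcen x y) (hcen y w) (hcen w x)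
  rw [hα] at hx hy
  rw [commPairing_eq_one_of_mem_zpowers hz hx (hmem y w),
    commPairing_eq_one_of_mem_zpowers hz hy (hmem w x), mul_one, mul_one] at hj
  rw [hα, MonoidHom.one_apply]
  exact commPairing_eq_one_of_mem_zpowers (hcen x y) hj
    (mem_zpowers_of_orderOf_prime ho (hmem x y) hxy)

include ho hG' in
theorem exists_injective_eval_pairingMap {x y : G} (hxy : ⁅x, y⁆ ≠ 1) :
    ∃ ev : (pairingMap z hz).range → rootsOfUnity p ℂ × rootsOfUnity p ℂ, Function.Injective ev ∧
      ∀ χ, ((ev χ).1 : ℂˣ) = χ.1 x ∧ ((ev χ).2 : ℂˣ) = χ.1 y := by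
  refine ⟨fun χ => ⟨⟨χ.1 x, ?_⟩, ⟨χ.1 y, ?_⟩⟩, ?_, fun χ => ⟨rfl, rfl⟩⟩
  · exact (mem_rootsOfUnity _ _).mpr (pow_eq_one_of_mem_range_pairingMap ho χ.2 x)
  · exact (mem_rootsOfUnity _ _).mpr (pow_eq_one_of_mem_range_pairingMap ho χ.2 y)
  · intro χ ψ h
    simp only [Prod.mk.injEq, Subtype.mk.injEq] at h
    have := eq_one_of_mem_range_pairingMap hz ho hG' hxy (χ := χ.1 * ψ.1⁻¹)
      (mul_mem χ.2 (inv_mem ψ.2)) (by simp [h.1]) (by simp [h.2])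
    exact Subtype.ext (mul_inv_eq_one.mp this)

theorem card_rootsOfUnity_sq : Nat.card (rootsOfUnity p ℂ × rootsOfUnity p ℂ) = p ^ 2 := by
  have : NeZero p := ⟨hp.out.ne_zero⟩
  rw [Nat.card_prod, Complex.card_rootsOfUnity, sq]

include ho hG' in
theorem card_range_pairingMap_le {x y : G} (hxy : ⁅x, y⁆ ≠ 1) :
    Nat.card (pairingMap z hz).range ≤ p ^ 2 := by
  have : NeZero p := ⟨hp.out.ne_zero⟩
  obtain ⟨ev, hev, -⟩ := exists_injective_eval_pairingMap hz ho hG' hxy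
  rw [← card_rootsOfUnity_sq (p := p)]
  exact Nat.card_le_card_of_injective ev hev

include ho hG' in
theorem exists_mem_range_pairingMap {x y : G} (hxy : ⁅x, y⁆ ≠ 1)
    (hc : p ^ 2 ≤ Nat.card (pairingMap z hz).range) {a b : ℂˣ} (ha : a ^ p = 1) (hb : b ^ p = 1) :
    ∃ χ ∈ (pairingMap z hz).range, χ x = a ∧ χ y = b := by
  have : NeZero p := ⟨hp.out.ne_zero⟩
  obtain ⟨ev, hev, hval⟩ := exists_injective_eval_pairingMap hz ho hG' hxy
  have hbij := hev.bijective_of_nat_card_le (by rw [card_rootsOfUnity_sq (p := p)]; exact hc)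
  obtain ⟨χ, hχ⟩ := hbij.2 ⟨⟨a, (mem_rootsOfUnity _ _).mpr ha⟩, ⟨b, (mem_rootsOfUnity _ _).mpr hb⟩⟩
  refine ⟨χ.1, χ.2, ?_, ?_⟩
  · rw [← (hval χ).1, hχ]
  · rw [← (hval χ).2, hχ]

theorem exists_generator_of_normal_card_prime [Finite G] (hG : IsPGroup p G) {N : Subgroup G}
    [N.Normal] (hN : Nat.card N = p) : ∃ z ∈ center G, orderOf z = p ∧ N = zpowers z := by
  obtain ⟨z, hzN, hz, ho⟩ := exists_mem_center_of_normal hG (N := N) (by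
    rintro rfl
    rw [Subgroup.card_bot] at hN
    exact hp.out.one_lt.ne hN)
  exact ⟨z, hz, ho, eq_zpowers_of_card_prime hN hzN ho⟩

theorem exists_commutatorElement_ne_one (h : commutator G ≠ ⊥) : ∃ x y : G, ⁅x, y⁆ ≠ 1 := by
  by_contra! hc
  exact h (commutator_eq_bot_of_comm fun a b => commutatorElement_eq_one_iff_mul_comm.mp (hc a b))

include ho hG' in
/-- The case of a derived subgroup of order `p`. -/
theorem card_schurMultiplier_of_commutator_prime {n : ℕ} (hG : Nat.card G = p ^ (n + 1)) :
    Finite (SchurMultiplier G) ∧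
      p * Nat.card (SchurMultiplier G) ≤ Nat.card (SchurMultiplier (G ⧸ commutator G)) *
        Nat.card (pairingMap z hz).range ∧
      Nat.card (SchurMultiplier (G ⧸ commutator G)) ≤ p ^ n.choose 2 ∧
      ((∃ y : G, y ^ p ∉ commutator G) →
        Nat.card (SchurMultiplier (G ⧸ commutator G)) ≤ p ^ (n - 1).choose 2) := by
  have hfin : Finite G := Nat.finite_of_card_ne_zero (hG ▸ pow_ne_zero _ hp.out.ne_zero)
  have hQ : Nat.card (G ⧸ commutator G) = p ^ n := card_quotient_zpowers hG hG' ho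
  obtain ⟨hf, h1, h2⟩ := card_schurMultiplier_abelian n (G ⧸ commutator G)
    quotient_commutator_comm hQ
  refine ⟨(card_schurMultiplier_le hG' hz).1, ?_, h1, ?_⟩
  · exact prime_mul_card_schurMultiplier_le hG' hz ho (hG' ▸ mem_zpowers z)
  · rintro ⟨y, hy⟩
    refine h2 ⟨(y : G ⧸ commutator G), fun h => hy ?_⟩
    rwa [← QuotientGroup.mk_pow, QuotientGroup.eq_one_iff] at h

/-- Reduction along a central subgroup of order `p` in the derived subgroup. -/
theorem prime_mul_card_schurMultiplier_le_of_commutator [Finite G] {N : Subgroup G} [N.Normal]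
    (hN : N = zpowers z) (hz : z ∈ center G) (ho : orderOf z = p) (hz' : z ∈ commutator G)
    [Finite (SchurMultiplier (G ⧸ N))] :
    p * Nat.card (SchurMultiplier G) ≤
        Nat.card (SchurMultiplier (G ⧸ N)) * Nat.card (pairingMap z hz).range ∧
      Nat.card (pairingMap z hz).range ≤ (commutator G).index :=
  ⟨prime_mul_card_schurMultiplier_le hN hz ho hz', card_characters_le_index le_rfl _
    fun χ _ _ hg => Abelianization.commutator_subset_ker χ hg⟩

/-- Upper bound for the Schur multiplier of a group of order `p ^ (n + 1)` with derived subgroup of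
order `p ^ (k + 1)`. -/
theorem card_schurMultiplier_nonabelian (k : ℕ) : ∀ (n : ℕ) (G : Type) [Group G],
    Nat.card G = p ^ (n + 1) → Nat.card (commutator G) = p ^ (k + 1) →
      Finite (SchurMultiplier G) ∧ p ^ k * Nat.card (SchurMultiplier G) ≤ p ^ (n.choose 2 + 1) := by
  induction k with
  | zero =>
    intro n G _ hG hk
    have hfin : Finite G := Nat.finite_of_card_ne_zero (hG ▸ pow_ne_zero _ hp.out.ne_zero)
    rw [zero_add, pow_one] at hk
    obtain ⟨z, hz, ho, hG'⟩ := exists_generator_of_normal_card_prime (IsPGroup.of_card hG) hk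
    obtain ⟨x, y, hxy⟩ := exists_commutatorElement_ne_one (G := G) (by
      intro h
      rw [h, Subgroup.card_bot] at hk
      exact hp.out.one_lt.ne hk)
    obtain ⟨h1, h2, h3, -⟩ := card_schurMultiplier_of_commutator_prime hz ho hG' hG
    refine ⟨h1, ?_⟩
    have h4 := h2.trans (Nat.mul_le_mul h3 (card_range_pairingMap_le hz ho hG' hxy))
    have h5 : p ^ n.choose 2 * p ^ 2 = p * p ^ (n.choose 2 + 1) := by ring
    rw [h5] at h4
    simpa using Nat.le_of_mul_le_mul_left h4 hp.out.pos
  | succ k ih =>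
    intro n G _ hG hk
    have hfin : Finite G := Nat.finite_of_card_ne_zero (hG ▸ pow_ne_zero _ hp.out.ne_zero)
    obtain ⟨z, hz', hz, ho⟩ := exists_mem_center_of_normal (IsPGroup.of_card hG)
      (N := commutator G) (by
      intro h
      rw [h, Subgroup.card_bot] at hk
      exact (Nat.one_lt_pow (by omega) hp.out.one_lt).ne hk)
    obtain ⟨N, hN⟩ : ∃ N : Subgroup G, N = zpowers z := ⟨_, rfl⟩
    have hnor : N.Normal := normal_of_le_center (hN ▸ zpowers_le.mpr hz)
    have hNc : Nat.card N = p := by rw [hN, Nat.card_zpowers, ho]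
    have hkQ : Nat.card (commutator (G ⧸ N)) = p ^ (k + 1) := by
      have := card_commutator_quotient (N := N) (hN ▸ zpowers_le.mpr hz')
      rw [hNc, hk, pow_succ'] at this
      exact Nat.eq_of_mul_eq_mul_left hp.out.pos this
    have hQ : Nat.card (G ⧸ N) = p ^ n := card_quotient_zpowers hG hN ho
    have hidx : p ^ (k + 2) * (commutator G).index = p ^ (n + 1) := by
      rw [← hG, ← Subgroup.card_mul_index (commutator G), hk]
    have hn : n ≠ 0 := by
      rintro rfl
      have h1 : p ^ (k + 2) ∣ p ^ 1 := Dvd.intro _ hidx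
      have := (Nat.pow_dvd_pow_iff_le_right hp.out.one_lt).mp h1
      omega
    obtain ⟨n, rfl⟩ := Nat.exists_eq_succ_of_ne_zero hn
    obtain ⟨hf, hb⟩ := ih n (G ⧸ N) hQ hkQ
    obtain ⟨h1, h2⟩ := prime_mul_card_schurMultiplier_le_of_commutator hN hz ho hz'
    refine ⟨(card_schurMultiplier_le hN hz).1, ?_⟩
    have h3 := h1.trans (Nat.mul_le_mul_left _ h2)
    -- The extra factors p^(k+2) and p^k let the index of G' and the inductive bound be inserted
    -- without division. The final comparison of exponents has slack k, so only the step from |G'| =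
    -- p to p² is sharp.
    have h4 : p ^ (k + 2) * (p ^ (k + 1) * Nat.card (SchurMultiplier G)) * p ^ k ≤
        p ^ (k + 2) * p ^ ((n + 1).choose 2 + 1) * p ^ k := by
      calc _ = p ^ (k + 2) * p ^ k * p ^ k * (p * Nat.card (SchurMultiplier G)) := by ring
        _ ≤ p ^ (k + 2) * p ^ k * p ^ k *
            (Nat.card (SchurMultiplier (G ⧸ N)) * (commutator G).index) :=
          Nat.mul_le_mul_left _ h3
        _ = p ^ k * (p ^ k * Nat.card (SchurMultiplier (G ⧸ N))) *
            (p ^ (k + 2) * (commutator G).index) := by ring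
        _ ≤ p ^ k * p ^ (n.choose 2 + 1) * p ^ (n + 1 + 1) := by
          rw [hidx]; exact Nat.mul_le_mul_right _ (Nat.mul_le_mul_left _ hb)
        _ = p ^ (k + (n.choose 2 + 1) + (n + 1 + 1)) := by ring
        _ ≤ p ^ ((k + 2) + ((n + 1).choose 2 + 1) + k) := by
          apply Nat.pow_le_pow_right hp.out.pos
          rw [Nat.choose_succ_succ' n 1, Nat.choose_one_right, one_add_one_eq_two]
          omega
        _ = _ := by ring
    exact Nat.le_of_mul_le_mul_left (Nat.le_of_mul_le_mul_right h4 (pow_pos hp.out.pos _))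
      (pow_pos hp.out.pos _)

end Bounds

/-- A group generated by a central elementary abelian `p`-subgroup `C` and two elements `a`, `b` of
order `p` modulo `C` whose commutator is `z ∈ C`, with prescribed `p`-th powers of `a` and `b`. -/
structure IsHeisenbergType {G : Type} [Group G] (p : ℕ) (C : Subgroup G) (z a b : G) : Prop where
  le_center : C ≤ center G
  pow_eq_one : ∀ c ∈ C, c ^ p = 1
  mem : z ∈ C
  ne_one : z ≠ 1
  mul_eq : a * b = z * (b * a)
  a_pow : a ^ p = 1
  -- For odd p the right side is 1; for p = 2 it is z⁻¹, as in the dihedral group of order 8. One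
  -- formula covers both cases.
  b_pow : b ^ p = (z ^ p.choose 2)⁻¹
  exists_eq : ∀ g, ∃ c ∈ C, ∃ i j : ℤ, g = c * b ^ i * a ^ j
  dvd : ∀ c ∈ C, ∀ i j : ℤ, c * b ^ i * a ^ j = 1 → (p : ℤ) ∣ i ∧ (p : ℤ) ∣ j

/-! ### A nontrivial pairing character forces Heisenberg type -/

section

variable {G : Type} [Group G]

theorem zpow_mul_zpow_of_central {a b z : G} (hz : z ∈ center G) (h : a * b = z * (b * a))
    (j k : ℤ) : a ^ j * b ^ k = z ^ (j * k) * (b ^ k * a ^ j) := by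
  have hzc : ∀ g : G, Commute z g := fun g => (Subgroup.mem_center_iff.mp hz g).symm
  have h1 : a * b ^ k * a⁻¹ = z ^ k * b ^ k := by
    rw [← conj_zpow, ← (hzc b).mul_zpow, h]; congr 1; group
  have h2 : (b ^ k)⁻¹ * a * (b ^ k)⁻¹⁻¹ = z ^ k * a := by
    have : a * b ^ k = z ^ k * b ^ k * a := mul_inv_eq_iff_eq_mul.mp h1
    rw [inv_inv, mul_assoc, this, ((hzc (b ^ k)).zpow_left k).eq]; group
  have h3 : (b ^ k)⁻¹ * a ^ j * (b ^ k)⁻¹⁻¹ = z ^ (j * k) * a ^ j := by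
    rw [← conj_zpow, h2, ((hzc a).zpow_left k).mul_zpow, ← zpow_mul, mul_comm k j]
  have h4 : a ^ j * b ^ k = b ^ k * (z ^ (j * k) * a ^ j) := by
    rw [← h3]; group
  rw [h4, ← mul_assoc, ← ((hzc (b ^ k)).zpow_left _).eq, mul_assoc]

/-- Collecting: the successive factors b pass 0, 1, …, k − 1 factors a, each passage costing one z.
-/
theorem mul_pow_of_central {a b z : G} (hz : z ∈ center G) (h : a * b = z * (b * a)) (k : ℕ) :
    (b * a) ^ k = z ^ k.choose 2 * (b ^ k * a ^ k) := by
  have hzc : ∀ (g : G) (i : ℕ), Commute (z ^ i) g := fun g i =>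
    (show Commute z g from (Subgroup.mem_center_iff.mp hz g).symm).pow_left i
  induction k with
  | zero => simp
  | succ k ih =>
    have h1 : a ^ k * b = z ^ k * (b * a ^ k) := by
      have := zpow_mul_zpow_of_central hz h k 1
      simpa [zpow_natCast] using this
    calc (b * a) ^ (k + 1) = z ^ k.choose 2 * b ^ k * (a ^ k * b) * a := by
          rw [pow_succ, ih]; group
      _ = z ^ k.choose 2 * (b ^ k * z ^ k) * b * a ^ k * a := by rw [h1]; simp only [mul_assoc]
      _ = z ^ k.choose 2 * z ^ k * (b ^ k * b) * (a ^ k * a) := by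
          rw [← (hzc (b ^ k) k).eq]; simp only [mul_assoc]
      _ = _ := by
          rw [← pow_add, ← pow_succ, ← pow_succ, Nat.choose_succ_succ' k 1, Nat.choose_one_right,
            add_comm (k.choose 2), mul_assoc]

variable {p : ℕ} [hp : Fact p.Prime]

theorem mem_zpowers_of_pow_eq_one {u v : ℂˣ} (hu : u ^ p = 1) (hv : v ^ p = 1) (hu1 : u ≠ 1) :
    v ∈ zpowers u := by
  have : NeZero p := ⟨hp.out.ne_zero⟩
  have := mem_zpowers_of_prime_card (G := rootsOfUnity p ℂ) (Complex.card_rootsOfUnity p)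
    (g := ⟨u, (mem_rootsOfUnity _ _).mpr hu⟩) (g' := ⟨v, (mem_rootsOfUnity _ _).mpr hv⟩)
    (by simpa [Subtype.ext_iff] using hu1)
  obtain ⟨j, hj⟩ := Subgroup.mem_zpowers_iff.mp this
  exact Subgroup.mem_zpowers_iff.mpr ⟨j, by simpa using congrArg Subtype.val hj⟩

theorem dvd_of_zpow_eq_one {H : Type*} [Group H] {u : H} (hu : u ^ p = 1) (hu1 : u ≠ 1) {j : ℤ}
    (h : u ^ j = 1) : (p : ℤ) ∣ j := by
  rw [← orderOf_eq_prime hu hu1]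
  exact orderOf_dvd_iff_zpow_eq_one.mpr h

variable {z : G} (hz : z ∈ center G) (ho : orderOf z = p) (hG' : commutator G = zpowers z)

include hG' in
-- If [x, y] ≠ 1, it generates ⟨z⟩, and the Jacobi identity makes the pairing of w with z trivial.
theorem commute_of_mem_ker_pairing {χ : G →* ℂˣ} (hχ : χ ∈ (pairingMap z hz).range) {w : G}
    (hw : χ w ≠ 1) (ho : orderOf z = p) {x y : G} (hx : χ x = 1) (hy : χ y = 1) :
    x * y = y * x := by
  obtain ⟨α, hα⟩ := exists_commPairing_of_mem_range hχ
  have hmem : ∀ u v : G, ⁅u, v⁆ ∈ zpowers z := fun u v =>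
    hG' ▸ commutatorElement_mem_commutator u v
  have hcen : ∀ u v : G, ⁅u, v⁆ ∈ center G := fun u v => zpowers_le.mpr hz (hmem u v)
  rw [← commutatorElement_eq_one_iff_mul_comm]
  by_contra hxy
  have hj := commPairing_jacobi (α := α) (hcen x y) (hcen y w) (hcen w x)
  rw [hα] at hx hy
  rw [commPairing_eq_one_of_mem_zpowers hz hx (hmem y w),
    commPairing_eq_one_of_mem_zpowers hz hy (hmem w x), mul_one, mul_one] at hj
  rw [hα] at hw
  exact hw (commPairing_eq_one_of_mem_zpowers (hcen x y) hj
    (mem_zpowers_of_orderOf_prime ho (hmem x y) hxy))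

include ho in
-- Otherwise z would be a power of x^p, and x pairs trivially with the powers of x^p.
theorem pow_eq_one_of_pairing_ne_one {χ : G →* ℂˣ} (hχ : χ ∈ (pairingMap z hz).range) {x : G}
    (hx : χ x ≠ 1) (hxp : x ^ p ∈ zpowers z) : x ^ p = 1 := by
  obtain ⟨α, hα⟩ := exists_commPairing_of_mem_range hχ
  by_contra h
  refine hx ?_
  rw [hα]
  have hc : x ^ p ∈ center G := zpowers_le.mpr hz hxp
  exact commPairing_eq_one_of_mem_zpowers hc (commPairing_self_pow x p)
    (mem_zpowers_of_orderOf_prime ho hxp h)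

include ho hG' in
/-- A nontrivial character in the image of the pairing forces the Heisenberg-type structure. -/
theorem exists_isHeisenbergType_of_pairing (hel : ∀ x : G, x ^ p ∈ commutator G) {χ : G →* ℂˣ}
    (hχ : χ ∈ (pairingMap z hz).range) (hχ1 : χ ≠ 1) :
    ∃ (C : Subgroup G) (z' a b : G), IsHeisenbergType p C z' a b := by
  obtain ⟨a, ha⟩ : ∃ a, χ a ≠ 1 := by
    by_contra! h
    exact hχ1 (by ext1 g; exact h g)
  have hpow : ∀ g, χ g ^ p = 1 := pow_eq_one_of_mem_range_pairingMap ho hχ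
  have hN : ∀ x y, χ x = 1 → χ y = 1 → x * y = y * x := fun x y =>
    commute_of_mem_ker_pairing hz hG' hχ ha ho
  have hout : ∀ x, χ x ≠ 1 → x ^ p = 1 := fun x hx =>
    pow_eq_one_of_pairing_ne_one hz ho hχ hx (hG' ▸ hel x)
  have hrep : ∀ g, ∃ n, χ n = 1 ∧ ∃ j : ℤ, g = n * a ^ j := by
    intro g
    obtain ⟨j, hj⟩ := Subgroup.mem_zpowers_iff.mp (mem_zpowers_of_pow_eq_one (hpow a) (hpow g) ha)
    exact ⟨g * (a ^ j)⁻¹, by rw [map_mul, map_inv, map_zpow, hj, mul_inv_cancel], j, by simp⟩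
  have hcentral : ∀ c, χ c = 1 → a * c = c * a → c ∈ center G := by
    intro c hc hac
    rw [Subgroup.mem_center_iff]
    intro g
    obtain ⟨n, hn, j, rfl⟩ := hrep g
    have h1 : Commute c n := hN c n hc hn
    have h2 : Commute c a := hac.symm
    exact (h1.mul_right (h2.zpow_right j)).symm
  obtain ⟨b, hb, hab⟩ : ∃ b, χ b = 1 ∧ ⁅a, b⁆ ≠ 1 := by
    by_contra! h
    have hac : a ∈ center G := by
      rw [Subgroup.mem_center_iff]
      intro g
      obtain ⟨n, hn, j, rfl⟩ := hrep g
      have h1 : Commute a n := commutatorElement_eq_one_iff_commute.mp (h n hn)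
      exact (h1.mul_right ((Commute.refl a).zpow_right j)).symm
    have hcomm : ∀ x y : G, x * y = y * x := by
      intro x y
      obtain ⟨n, hn, j, rfl⟩ := hrep x
      have h1 : Commute n y := (Subgroup.mem_center_iff.mp
        (hcentral n hn (Subgroup.mem_center_iff.mp hac n).symm) y).symm
      have h2 : Commute a y := (Subgroup.mem_center_iff.mp hac y).symm
      exact h1.mul_left (h2.zpow_left j)
    have := commutator_eq_bot_of_comm hcomm
    rw [hG', zpowers_eq_bot] at this
    rw [this, orderOf_one] at ho
    exact hp.out.one_lt.ne ho
  have hmem : ∀ u v : G, ⁅u, v⁆ ∈ zpowers z := fun u v =>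
    hG' ▸ commutatorElement_mem_commutator u v
  set z' := ⁅a, b⁆ with hz'
  have hz'c : z' ∈ center G := zpowers_le.mpr hz (hmem a b)
  have hz'p : z' ^ p = 1 := by
    obtain ⟨i, hi⟩ := Subgroup.mem_zpowers_iff.mp (hmem a b)
    rw [hz', ← hi, ← zpow_natCast, ← zpow_mul, mul_comm, zpow_mul, zpow_natCast, ← ho,
      pow_orderOf_eq_one, one_zpow]
  have hχz' : χ z' = 1 := by
    rw [hz', map_commutatorElement, commutatorElement_eq_one_iff_commute]; exact mul_comm _ _
  have hmul : a * b = z' * (b * a) := by rw [hz', commutatorElement_def]; group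
  -- Elements outside ker χ have trivial p-th power. Applied to ac this bounds the exponent of C,
  -- and applied to ba, expanded by collection, it gives b^p.
  refine ⟨χ.ker ⊓ center G, z', a, b, inf_le_right, ?_, ⟨hχz', hz'c⟩, hab, hmul, hout a ha, ?_,
    ?_, ?_⟩
  · rintro c ⟨hc, hcc⟩
    have h1 : (a * c) ^ p = 1 := hout _ (by rw [map_mul, show χ c = 1 from hc, mul_one]; exact ha)
    rw [(show Commute a c from Subgroup.mem_center_iff.mp hcc a).mul_pow, hout a ha, one_mul] at h1
    exact h1
  · have h1 : (b * a) ^ p = 1 := hout _ (by rw [map_mul, hb, one_mul]; exact ha)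
    rw [mul_pow_of_central hz'c hmul, hout a ha, mul_one] at h1
    exact eq_inv_of_mul_eq_one_right h1
  · intro g
    obtain ⟨n, hn, j, rfl⟩ := hrep g
    obtain ⟨i, hi⟩ := Subgroup.mem_zpowers_iff.mp ((zpowers_le.mpr
      (mem_zpowers_of_orderOf_prime ho (hmem a b) hab)) (hmem a n))
    have h1 : a * n = z' ^ i * (n * a) := by rw [hi, commutatorElement_def]; group
    have hχc : χ (n * (b ^ i)⁻¹) = 1 := by rw [map_mul, map_inv, map_zpow, hn, hb]; simp
    -- The power of b is chosen to cancel [a, n] = z'^i; what remains commutes with a and lies in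
    -- the abelian kernel, so it is central.
    refine ⟨n * (b ^ i)⁻¹, ⟨hχc, hcentral _ hχc ?_⟩, i, j, by simp⟩
    have h2 := zpow_mul_zpow_of_central hz'c hmul 1 (-i)
    rw [zpow_one, one_mul] at h2
    rw [← zpow_neg, ← mul_assoc, h1, mul_assoc, mul_assoc, h2, ← mul_assoc n,
      Subgroup.mem_center_iff.mp (zpow_mem hz'c _) n, mul_assoc, ← mul_assoc, ← zpow_add,
      add_neg_cancel, zpow_zero, one_mul, mul_assoc]
  · rintro c ⟨hc, hcc⟩ i j h
    have h1 := congrArg χ h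
    rw [map_mul, map_mul, show χ c = 1 from hc, map_zpow, map_zpow, hb, one_zpow, one_mul, one_mul,
      map_one] at h1
    have hj := dvd_of_zpow_eq_one (hpow a) ha h1
    refine ⟨?_, hj⟩
    obtain ⟨k, rfl⟩ := hj
    rw [zpow_mul, zpow_natCast, hout a ha, one_zpow, mul_one] at h
    have hbi : b ^ i ∈ center G := by
      rw [← inv_eq_of_mul_eq_one_right h]; exact inv_mem hcc
    have h2 := zpow_mul_zpow_of_central hz'c hmul 1 i
    rw [zpow_one, one_mul, Subgroup.mem_center_iff.mp hbi a] at h2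
    exact dvd_of_zpow_eq_one hz'p hab (right_eq_mul.mp h2)

end

/-! ### Isomorphisms from graphs, and transitivity on nonzero vectors -/

section

/-- A graph-like subgroup of a product with trivial fibres over `1` gives an isomorphism. -/
theorem exists_mulEquiv_of_graph {G H : Type} [Group G] [Group H] (Γ : Subgroup (G × H))
    (h1 : ∀ g, ∃ h, (g, h) ∈ Γ) (h2 : ∀ h, ∃ g, (g, h) ∈ Γ) (h3 : ∀ h, (1, h) ∈ Γ → h = 1)
    (h4 : ∀ g, (g, 1) ∈ Γ → g = 1) : Nonempty (G ≃* H) := by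
  have hb1 : Function.Bijective (Prod.fst ∘ Γ.subtype) := by
    refine ⟨(injective_iff_map_eq_one ((MonoidHom.fst G H).comp Γ.subtype)).mpr ?_, fun g => ?_⟩
    · rintro ⟨⟨g, h⟩, hq⟩ he
      have hg : g = 1 := he
      subst hg
      have := h3 h hq
      subst this
      rfl
    · obtain ⟨h, hh⟩ := h1 g
      exact ⟨⟨_, hh⟩, rfl⟩
  have hb2 : Function.Bijective (Prod.snd ∘ Γ.subtype) := by
    refine ⟨(injective_iff_map_eq_one ((MonoidHom.snd G H).comp Γ.subtype)).mpr ?_, fun h => ?_⟩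
    · rintro ⟨⟨g, h⟩, hq⟩ he
      have hg : h = 1 := he
      subst hg
      have := h4 g hq
      subst this
      rfl
    · obtain ⟨g, hh⟩ := h2 h
      exact ⟨⟨_, hh⟩, rfl⟩
  obtain ⟨e, -⟩ := Subgroup.exists_mulEquiv_eq_graph hb1 hb2
  exact ⟨e⟩

/-- After identifying V with W by dimension, an isomorphism between the two lines extends to an
automorphism of W. -/
theorem exists_linearEquiv_apply_eq {K V W : Type} [Field K] [Finite K] [AddCommGroup V]
    [AddCommGroup W] [Module K V] [Module K W] [Finite V] [Finite W]
    (hc : Nat.card V = Nat.card W) {v : V} {w : W} (hv : v ≠ 0) (hw : w ≠ 0) :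
    ∃ e : V ≃ₗ[K] W, e v = w := by
  have hr : Module.finrank K V = Module.finrank K W := by
    have h1 := Module.natCard_eq_pow_finrank (K := K) (V := V)
    have h2 := Module.natCard_eq_pow_finrank (K := K) (V := W)
    refine Nat.pow_right_injective (Finite.one_lt_card (α := K)) ?_
    change Nat.card K ^ _ = Nat.card K ^ _
    rw [← h1, ← h2, hc]
  let e : V ≃ₗ[K] W := LinearEquiv.ofFinrankEq _ _ hr
  have hev : e v ≠ 0 := fun h => hv (e.map_eq_zero_iff.mp h)
  let f := (LinearEquiv.toSpanNonzeroSingleton K W _ hev).symm.trans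
    (LinearEquiv.toSpanNonzeroSingleton K W _ hw)
  obtain ⟨g, hg⟩ := Submodule.exists_linearEquiv_restrict_eq f
  refine ⟨e.trans g, ?_⟩
  have h1 := hg ⟨e v, Submodule.mem_span_singleton_self _⟩
  have h2 : (LinearEquiv.toSpanNonzeroSingleton K W _ hev).symm
      ⟨e v, Submodule.mem_span_singleton_self _⟩ = 1 := by
    rw [LinearEquiv.symm_apply_eq, LinearEquiv.toSpanNonzeroSingleton_one]
  simp only [f, LinearEquiv.trans_apply, h2, LinearEquiv.toSpanNonzeroSingleton_one] at h1
  exact h1.symm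

theorem exists_mulEquiv_apply_eq {p : ℕ} [hp : Fact p.Prime] {A B : Type} [CommGroup A]
    [CommGroup B] [Finite A] [Finite B] (hA : ∀ a : A, a ^ p = 1) (hB : ∀ b : B, b ^ p = 1)
    (hc : Nat.card A = Nat.card B) {a : A} {b : B} (ha : a ≠ 1) (hb : b ≠ 1) :
    ∃ e : A ≃* B, e a = b := by
  let _ : Module (ZMod p) (Additive A) := AddCommGroup.zmodModule fun x => hA x.toMul
  let _ : Module (ZMod p) (Additive B) := AddCommGroup.zmodModule fun x => hB x.toMul
  have hfA : Finite (Additive A) := ‹Finite A›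
  have hfB : Finite (Additive B) := ‹Finite B›
  obtain ⟨e, he⟩ := exists_linearEquiv_apply_eq (K := ZMod p) (V := Additive A) (W := Additive B)
    hc (v := Additive.ofMul a) (w := Additive.ofMul b) ha hb
  exact ⟨MulEquiv.toAdditive.symm e.toAddEquiv, he⟩

end

/-! ### Uniqueness of groups of Heisenberg type -/

namespace IsHeisenbergType

variable {G : Type} [Group G] {p : ℕ} [hp : Fact p.Prime] {C : Subgroup G} {z a b : G}

omit hp in
theorem mul_mul_eq (h : IsHeisenbergType p C z a b) {c d : G} (hd : d ∈ C) (i j k l : ℤ) :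
    (c * b ^ i * a ^ j) * (d * b ^ k * a ^ l) =
      (c * d * z ^ (j * k)) * b ^ (i + k) * a ^ (j + l) := by
  have hdc := Subgroup.mem_center_iff.mp (h.le_center hd)
  have hzc := Subgroup.mem_center_iff.mp (zpow_mem (h.le_center h.mem) (j * k))
  calc _ = c * ((b ^ i * a ^ j) * d) * b ^ k * a ^ l := by simp only [mul_assoc]
    _ = c * d * b ^ i * (a ^ j * b ^ k) * a ^ l := by rw [hdc]; simp only [mul_assoc]
    _ = c * d * (b ^ i * z ^ (j * k)) * (b ^ k * a ^ j) * a ^ l := by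
      rw [zpow_mul_zpow_of_central (h.le_center h.mem) h.mul_eq]; simp only [mul_assoc]
    _ = _ := by rw [hzc, zpow_add, zpow_add]; simp only [mul_assoc]

omit hp in
theorem inv_eq (h : IsHeisenbergType p C z a b) {c : G} (hc : c ∈ C) (i j : ℤ) :
    (c * b ^ i * a ^ j)⁻¹ = (c⁻¹ * z ^ (j * i)) * b ^ (-i) * a ^ (-j) := by
  rw [inv_eq_iff_mul_eq_one, h.mul_mul_eq (mul_mem (inv_mem hc) (zpow_mem h.mem _))]
  simp

omit hp in
theorem b_zpow (h : IsHeisenbergType p C z a b) (k : ℤ) :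
    b ^ ((p : ℤ) * k) = z ^ (-(p.choose 2 : ℤ) * k) := by
  rw [zpow_mul, zpow_natCast, h.b_pow, zpow_mul, zpow_neg, zpow_natCast]

omit hp in
theorem a_zpow (h : IsHeisenbergType p C z a b) (k : ℤ) : a ^ ((p : ℤ) * k) = 1 := by
  rw [zpow_mul, zpow_natCast, h.a_pow, one_zpow]

theorem card_eq (h : IsHeisenbergType p C z a b) : Nat.card G = Nat.card C * (p * p) := by
  have hbij : Function.Bijective (fun q : C × (Fin p × Fin p) =>
      (q.1 : G) * b ^ (q.2.1 : ℤ) * a ^ (q.2.2 : ℤ)) := by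
    constructor
    · rintro ⟨c, i, j⟩ ⟨d, k, l⟩ he
      have he' := mul_inv_eq_one.mpr he
      simp only at he'
      rw [h.inv_eq d.2, h.mul_mul_eq (mul_mem (inv_mem d.2) (zpow_mem h.mem _))] at he'
      obtain ⟨h1, h2⟩ := h.dvd _ (mul_mem (mul_mem c.2 (mul_mem (inv_mem d.2) (zpow_mem h.mem _)))
        (zpow_mem h.mem _)) _ _ he'
      have hik : i = k := by
        have := Int.eq_zero_of_abs_lt_dvd h1 (by rw [abs_lt]; omega)
        apply Fin.ext; omega
      have hjl : j = l := by
        have := Int.eq_zero_of_abs_lt_dvd h2 (by rw [abs_lt]; omega)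
        apply Fin.ext; omega
      subst hik hjl
      simp only [mul_left_inj] at he
      rw [Subtype.ext he]
    · intro g
      obtain ⟨c, hc, i, j, rfl⟩ := h.exists_eq g
      have hp0 : (0 : ℤ) < p := by exact_mod_cast hp.out.pos
      have hi1 := Int.emod_nonneg i hp0.ne'
      have hi2 := Int.emod_lt_of_pos i hp0
      have hj1 := Int.emod_nonneg j hp0.ne'
      have hj2 := Int.emod_lt_of_pos j hp0
      -- Reducing the exponent of b modulo p leaves a multiple of p, whose contribution is a power
      -- of z and is absorbed into C.
      refine ⟨⟨⟨c * z ^ (-(p.choose 2 : ℤ) * (i / p)), mul_mem hc (zpow_mem h.mem _)⟩,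
        ⟨(i % p).toNat, by omega⟩, ⟨(j % p).toNat, by omega⟩⟩, ?_⟩
      simp only [Int.toNat_of_nonneg hi1, Int.toNat_of_nonneg hj1]
      conv_rhs => rw [← Int.mul_ediv_add_emod i p, ← Int.mul_ediv_add_emod j p, zpow_add, zpow_add,
        h.b_zpow, h.a_zpow, one_mul]
      simp only [mul_assoc]
  rw [← Nat.card_congr (Equiv.ofBijective _ hbij)]
  simp

omit hp in
-- A relation between normal forms has exponents divisible by p, so it reduces to a relation in C
-- involving z, which θ transports. This replaces a check that the isomorphism is well defined.
theorem fibre_eq_one (h : IsHeisenbergType p C z a b) {H : Type} [Group H] {C' : Subgroup H}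
    {z' a' b' : H} (h' : IsHeisenbergType p C' z' a' b') (θ : C →* C')
    (hθ : (θ ⟨z, h.mem⟩ : H) = z') (c : C) (i j : ℤ) (he : (c : G) * b ^ i * a ^ j = 1) :
    (θ c : H) * b' ^ i * a' ^ j = 1 := by
  obtain ⟨⟨k, rfl⟩, ⟨l, rfl⟩⟩ := h.dvd _ c.2 _ _ he
  rw [h.b_zpow, h.a_zpow, mul_one] at he
  rw [h'.b_zpow, h'.a_zpow, mul_one, ← hθ]
  have h1 : c * (⟨z, h.mem⟩ : C) ^ (-(p.choose 2 : ℤ) * k) = 1 := Subtype.ext (by simpa using he)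
  have h2 := congrArg (fun x : C => (θ x : H)) h1
  simpa using h2

/-- Groups of the same order with Heisenberg-type structure are isomorphic. -/
theorem nonempty_mulEquiv [Finite G] (h : IsHeisenbergType p C z a b) {H : Type} [Group H]
    [Finite H] {C' : Subgroup H} {z' a' b' : H} (h' : IsHeisenbergType p C' z' a' b')
    (hc : Nat.card G = Nat.card H) : Nonempty (G ≃* H) := by
  have hcC : Nat.card C = Nat.card C' := by
    rw [h.card_eq, h'.card_eq] at hc
    exact Nat.eq_of_mul_eq_mul_right (Nat.mul_pos hp.out.pos hp.out.pos) hc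
  let _ : CommGroup C := { (inferInstance : Group C) with
    mul_comm := fun x y => Subtype.ext (Subgroup.mem_center_iff.mp (h.le_center y.2) x) }
  let _ : CommGroup C' := { (inferInstance : Group C') with
    mul_comm := fun x y => Subtype.ext (Subgroup.mem_center_iff.mp (h'.le_center y.2) x) }
  obtain ⟨θ, hθ⟩ := exists_mulEquiv_apply_eq (p := p) (A := C) (B := C')
    (fun x => Subtype.ext (by simpa using h.pow_eq_one x x.2))
    (fun x => Subtype.ext (by simpa using h'.pow_eq_one x x.2)) hcC
    (a := ⟨z, h.mem⟩) (b := ⟨z', h'.mem⟩) (fun e => h.ne_one (congrArg Subtype.val e))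
    (fun e => h'.ne_one (congrArg Subtype.val e))
  let Γ : Subgroup (G × H) :=
    { carrier := {q | ∃ (c : C) (i j : ℤ), q = ((c : G) * b ^ i * a ^ j,
        (θ c : H) * b' ^ i * a' ^ j)}
      one_mem' := ⟨1, 0, 0, by simp; rfl⟩
      mul_mem' := by
        rintro _ _ ⟨c, i, j, rfl⟩ ⟨d, k, l, rfl⟩
        refine ⟨c * d * (⟨z, h.mem⟩ : C) ^ (j * k), i + k, j + l, ?_⟩
        rw [Prod.mk_mul_mk, h.mul_mul_eq d.2, h'.mul_mul_eq (θ d).2, map_mul, map_mul, map_zpow, hθ]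
        simp
      inv_mem' := by
        rintro _ ⟨c, i, j, rfl⟩
        refine ⟨c⁻¹ * (⟨z, h.mem⟩ : C) ^ (j * i), -i, -j, ?_⟩
        rw [Prod.inv_mk, h.inv_eq c.2, h'.inv_eq (θ c).2, map_mul, map_inv, map_zpow, hθ]
        simp }
  refine exists_mulEquiv_of_graph Γ ?_ ?_ ?_ ?_
  · intro g
    obtain ⟨c, hc, i, j, rfl⟩ := h.exists_eq g
    exact ⟨_, ⟨c, hc⟩, i, j, rfl⟩
  · intro g
    obtain ⟨c, hc, i, j, rfl⟩ := h'.exists_eq g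
    exact ⟨_, θ.symm ⟨c, hc⟩, i, j, by simp; rfl⟩
  · rintro g ⟨c, i, j, e⟩
    rw [Prod.mk.injEq] at e
    rw [e.2]
    exact h.fibre_eq_one h' θ.toMonoidHom (congrArg Subtype.val hθ) c i j e.1.symm
  · rintro g ⟨c, i, j, e⟩
    rw [Prod.mk.injEq] at e
    rw [e.1]
    have := h'.fibre_eq_one h θ.symm.toMonoidHom (congrArg Subtype.val
      ((MulEquiv.symm_apply_eq θ).mpr hθ.symm)) (θ c) i j e.2.symm
    simpa using this

end IsHeisenbergType

/-! ### Large multiplier with derived subgroup of order p -/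

section CommutatorPrime

variable {G : Type} [Group G] {p : ℕ} [hp : Fact p.Prime]

theorem not_comm_of_card_commutator {k : ℕ} (hk : Nat.card (commutator G) = p ^ (k + 1)) :
    commutator G ≠ ⊥ := by
  intro h
  rw [h, Subgroup.card_bot] at hk
  exact (Nat.one_lt_pow (by omega) hp.out.one_lt).ne hk

/-- If `|G'| = p` and the Schur multiplier is large, then `G / G'` is elementary abelian. -/
theorem pow_mem_commutator_of_card_le {n : ℕ} (hG : Nat.card G = p ^ (n + 1))
    (hk : Nat.card (commutator G) = p) (hM : p ^ n.choose 2 ≤ Nat.card (SchurMultiplier G))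
    (y : G) : y ^ p ∈ commutator G := by
  have hfin : Finite G := Nat.finite_of_card_ne_zero (hG ▸ pow_ne_zero _ hp.out.ne_zero)
  obtain ⟨z, hz, ho, hG'⟩ := exists_generator_of_normal_card_prime (IsPGroup.of_card hG) hk
  have hne : commutator G ≠ ⊥ := not_comm_of_card_commutator (p := p) (k := 0) (by simpa using hk)
  obtain ⟨x, y', hxy⟩ := exists_commutatorElement_ne_one hne
  by_contra hy
  obtain ⟨-, h2, -, h4⟩ := card_schurMultiplier_of_commutator_prime hz ho hG' hG
  have h5 := h2.trans (Nat.mul_le_mul (h4 ⟨y, hy⟩) (card_range_pairingMap_le hz ho hG' hxy))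
  have hQ : Nat.card (G ⧸ commutator G) = p ^ n := card_quotient_zpowers hG hG' ho
  have hyQ : (y : G ⧸ commutator G) ^ p ≠ 1 := fun h => hy (by
    rwa [← QuotientGroup.mk_pow, QuotientGroup.eq_one_iff] at h)
  -- A quotient that is not elementary would give (n choose 2) + 1 ≤ (n − 1 choose 2) + 2. With n ≤
  -- 2 the element y, of order at least p² modulo G', generates G/G'; as G' is central, G would be
  -- abelian.
  have hn : n ≤ 2 := by
    have h6 : p ^ (n.choose 2 + 1) ≤ p ^ ((n - 1).choose 2 + 2) := by
      calc p ^ (n.choose 2 + 1) = p * p ^ n.choose 2 := pow_succ' _ _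
        _ ≤ _ := (Nat.mul_le_mul_left _ hM).trans h5
        _ = _ := by rw [pow_add]
    have h7 := (Nat.pow_le_pow_iff_right hp.out.one_lt).mp h6
    rcases n with _ | n
    · omega
    · rw [Nat.choose_succ_succ' n 1, Nat.choose_one_right, one_add_one_eq_two,
        Nat.add_sub_cancel] at h7
      omega
  have hord : orderOf (y : G ⧸ commutator G) = Nat.card (G ⧸ commutator G) := by
    obtain ⟨j, hj, hje⟩ := (Nat.dvd_prime_pow hp.out).mp (hQ ▸ orderOf_dvd_natCard
      (y : G ⧸ commutator G))
    have hj2 : 2 ≤ j := by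
      by_contra hlt
      refine hyQ (orderOf_dvd_iff_pow_eq_one.mp ?_)
      rw [hje]
      exact (pow_dvd_pow p (show j ≤ 1 by omega)).trans (by simp)
    rw [hje, hQ, show j = n by omega]
  have hcyc : IsCyclic (G ⧸ commutator G) := isCyclic_of_orderOf_eq_card _ hord
  have hcomm : IsMulCommutative G := MonoidHom.isMulCommutative_of_isCyclic_of_ker_le_center
    (QuotientGroup.mk' (commutator G))
    (by rw [QuotientGroup.ker_mk', hG']; exact zpowers_le.mpr hz)
  exact hne (commutator_eq_bot_of_comm fun a b => hcomm.is_comm.comm a b)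

/-- The upper bound read backwards: a large multiplier forces many pairing characters. -/
theorem le_card_range_pairingMap {n e : ℕ} (hG : Nat.card G = p ^ (n + 1)) {z : G}
    (hz : z ∈ center G) (ho : orderOf z = p) (hG' : commutator G = zpowers z)
    (hM : p ^ (n.choose 2 + e) ≤ Nat.card (SchurMultiplier G)) :
    p ^ (e + 1) ≤ Nat.card (pairingMap z hz).range := by
  obtain ⟨-, h2, h3, -⟩ := card_schurMultiplier_of_commutator_prime hz ho hG' hG
  have h5 := (Nat.mul_le_mul_left p hM).trans (h2.trans (Nat.mul_le_mul_right _ h3))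
  have h6 : p * p ^ (n.choose 2 + e) = p ^ n.choose 2 * p ^ (e + 1) := by ring
  rw [h6] at h5
  exact Nat.le_of_mul_le_mul_left h5 (pow_pos hp.out.pos _)

/-- Groups with `|G'| = p` and large Schur multiplier are of Heisenberg type. -/
theorem exists_isHeisenbergType {n : ℕ} (hG : Nat.card G = p ^ (n + 1))
    (hk : Nat.card (commutator G) = p) (hM : p ^ n.choose 2 ≤ Nat.card (SchurMultiplier G)) :
    ∃ (C : Subgroup G) (z a b : G), IsHeisenbergType p C z a b := by
  have hfin : Finite G := Nat.finite_of_card_ne_zero (hG ▸ pow_ne_zero _ hp.out.ne_zero)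
  obtain ⟨z, hz, ho, hG'⟩ := exists_generator_of_normal_card_prime (IsPGroup.of_card hG) hk
  have hr := le_card_range_pairingMap (e := 0) hG hz ho hG' (by simpa using hM)
  have := finite_characters G
  obtain ⟨χ, hχ, hχ1⟩ := (pairingMap z hz).range.bot_or_exists_ne_one.resolve_left (by
    intro h
    rw [h, Subgroup.card_bot] at hr
    simp only [zero_add, pow_one] at hr
    exact absurd hp.out.one_lt (by omega))
  exact exists_isHeisenbergType_of_pairing hz ho hG' (pow_mem_commutator_of_card_le hG hk hM) hχ hχ1

/-- The extremal case does not occur for `p = 2`. -/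
theorem ne_two_of_card_le {n : ℕ} (hG : Nat.card G = p ^ (n + 1))
    (hk : Nat.card (commutator G) = p)
    (hM : p ^ (n.choose 2 + 1) ≤ Nat.card (SchurMultiplier G)) : p ≠ 2 := by
  have hfin : Finite G := Nat.finite_of_card_ne_zero (hG ▸ pow_ne_zero _ hp.out.ne_zero)
  rintro rfl
  obtain ⟨z, hz, ho, hG'⟩ := exists_generator_of_normal_card_prime (IsPGroup.of_card hG) hk
  have hel := pow_mem_commutator_of_card_le hG hk
    ((Nat.pow_le_pow_right (by omega) (by omega)).trans hM)
  have hr := le_card_range_pairingMap (e := 1) hG hz ho hG' hM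
  obtain ⟨x, y, hxy⟩ := exists_commutatorElement_ne_one (G := G)
    (not_comm_of_card_commutator (p := 2) (k := 0) (by simpa using hk))
  have hneg : (-1 : ℂˣ) ≠ 1 := by
    intro h
    have := congrArg Units.val h
    norm_num at this
  -- All pairs of values at x and y occur, so x, y and xy each lie outside the kernel of some
  -- pairing character. All three then square to 1, and x and y would commute.
  obtain ⟨χ, hχ, hχx, hχy⟩ := exists_mem_range_pairingMap hz ho hG' hxy hr (a := -1) (b := 1)
    (by simp) (by simp)
  obtain ⟨ψ, hψ, hψx, hψy⟩ := exists_mem_range_pairingMap hz ho hG' hxy hr (a := 1) (b := -1)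
    (by simp) (by simp)
  have hx : x ^ 2 = 1 := pow_eq_one_of_pairing_ne_one hz ho hχ (by rw [hχx]; exact hneg)
    (hG' ▸ hel x)
  have hy : y ^ 2 = 1 := pow_eq_one_of_pairing_ne_one hz ho hψ (by rw [hψy]; exact hneg)
    (hG' ▸ hel y)
  have hxy2 : (x * y) ^ 2 = 1 := pow_eq_one_of_pairing_ne_one hz ho hχ
    (by rw [map_mul, hχx, hχy, mul_one]; exact hneg) (hG' ▸ hel _)
  apply hxy
  rw [sq] at hx hy hxy2
  rw [commutatorElement_def, ← eq_inv_of_mul_eq_one_left hx, mul_assoc _ x,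
    ← eq_inv_of_mul_eq_one_left hy]
  rw [← hxy2, mul_assoc]

theorem IsHeisenbergType.pow_eq_one_of_ne_two {C : Subgroup G} {z a b : G}
    (h : IsHeisenbergType p C z a b) (hp2 : p ≠ 2) (g : G) : g ^ p = 1 := by
  have hdvd : p ∣ p.choose 2 :=
    hp.out.dvd_choose_self (by omega) (lt_of_le_of_ne hp.out.two_le (Ne.symm hp2))
  have hzp : ∀ c ∈ C, c ^ p.choose 2 = 1 := fun c hc => by
    obtain ⟨k, hk⟩ := hdvd
    rw [hk, pow_mul, h.pow_eq_one _ hc, one_pow]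
  have hb : b ^ p = 1 := by rw [h.b_pow, hzp z h.mem, inv_one]
  obtain ⟨c, hc, i, j, rfl⟩ := h.exists_eq g
  have h1 : Commute c (b ^ i * a ^ j) := (Subgroup.mem_center_iff.mp (h.le_center hc) _).symm
  have h2 := mul_pow_of_central (zpow_mem (h.le_center h.mem) (j * i))
    (zpow_mul_zpow_of_central (h.le_center h.mem) h.mul_eq j i) p
  rw [mul_assoc, h1.mul_pow, h2, h.pow_eq_one c hc, hzp _ (zpow_mem h.mem _),
    ← zpow_natCast (b ^ i), ← zpow_natCast (a ^ j), ← zpow_mul, ← zpow_mul, mul_comm i, mul_comm j,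
    zpow_mul, zpow_mul, zpow_natCast, zpow_natCast, hb, h.a_pow]
  simp

end CommutatorPrime

/-! ### The extremal case with derived subgroup of order p²: class two -/

section CommutatorPrimeSq

variable {G : Type} [Group G] {p : ℕ} [hp : Fact p.Prime]

/-- The extremal case for `|G'| = p²`: every character is a pairing with every central element of
order `p` in `G'`, and the corresponding quotients are extremal too. -/
theorem extremal_of_card_commutator_sq {n : ℕ} (hG : Nat.card G = p ^ (n + 2))
    (hk : Nat.card (commutator G) = p ^ 2)
    (hM : p ^ (n + 1).choose 2 ≤ Nat.card (SchurMultiplier G)) {z : G} (hz' : z ∈ commutator G)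
    (hz : z ∈ center G) (ho : orderOf z = p) :
    (∀ χ : G →* ℂˣ, ∃ α : schurCocycles G, ∀ g, χ g = commPairing α.1 g z) ∧
      ∀ (N : Subgroup G) [N.Normal], N = zpowers z → Nat.card (G ⧸ N) = p ^ (n + 1) ∧
        Nat.card (commutator (G ⧸ N)) = p ∧
        p ^ (n.choose 2 + 1) ≤ Nat.card (SchurMultiplier (G ⧸ N)) := by
  have hfin : Finite G := Nat.finite_of_card_ne_zero (hG ▸ pow_ne_zero _ hp.out.ne_zero)
  have := finite_characters G
  have hidx : (commutator G).index = p ^ n := by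
    have := Subgroup.card_mul_index (commutator G)
    rw [hk, hG, add_comm, pow_add] at this
    exact Nat.eq_of_mul_eq_mul_left (pow_pos hp.out.pos _) this
  have key : ∀ (N : Subgroup G) [N.Normal], N = zpowers z → (Nat.card (G ⧸ N) = p ^ (n + 1) ∧
        Nat.card (commutator (G ⧸ N)) = p ∧
        p ^ (n.choose 2 + 1) ≤ Nat.card (SchurMultiplier (G ⧸ N))) ∧
        p ^ n ≤ Nat.card (pairingMap z hz).range := by
    intro N _ hN
    have hQ : Nat.card (G ⧸ N) = p ^ (n + 1) := card_quotient_zpowers hG hN ho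
    have hkQ : Nat.card (commutator (G ⧸ N)) = p := by
      have := card_commutator_quotient (N := N) (hN ▸ zpowers_le.mpr hz')
      rw [hk, sq, show Nat.card N = p by rw [hN, Nat.card_zpowers, ho]] at this
      exact Nat.eq_of_mul_eq_mul_left hp.out.pos this
    obtain ⟨hf, hb⟩ := card_schurMultiplier_nonabelian 0 n (G ⧸ N) hQ (by simpa using hkQ)
    rw [pow_zero, one_mul] at hb
    obtain ⟨h1, h2⟩ := prime_mul_card_schurMultiplier_le_of_commutator hN hz ho hz'
    rw [hidx] at h2
    -- The left side is the product of the upper bounds for the two factors on the right, so both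
    -- bounds are attained.
    have h3 : p ^ (n.choose 2 + 1) * p ^ n ≤
        Nat.card (SchurMultiplier (G ⧸ N)) * Nat.card (pairingMap z hz).range := by
      refine le_trans (le_of_eq ?_) ((Nat.mul_le_mul_left p hM).trans h1)
      rw [Nat.choose_succ_succ' n 1, Nat.choose_one_right, one_add_one_eq_two]
      ring
    refine ⟨⟨hQ, hkQ, ?_⟩, ?_⟩
    · exact Nat.le_of_mul_le_mul_right (h3.trans (Nat.mul_le_mul_left _ h2)) (pow_pos hp.out.pos _)
    · exact Nat.le_of_mul_le_mul_left (h3.trans (Nat.mul_le_mul_right _ hb)) (pow_pos hp.out.pos _)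
  refine ⟨fun χ => ?_, fun N _ hN => (key N hN).1⟩
  have hnor : (zpowers z).Normal := normal_of_le_center (zpowers_le.mpr hz)
  have hr := (key (zpowers z) rfl).2
  have htop : (pairingMap z hz).range = ⊤ := by
    apply Subgroup.eq_top_of_le_card
    refine le_trans (le_of_eq ?_) hr
    rw [Nat.card_congr (Abelianization.lift (G := G) (A := ℂˣ)),
      CommGroup.card_monoidHom_of_hasEnoughRootsOfUnity, ← hidx]
    rfl
  exact exists_commPairing_of_mem_range (htop ▸ mem_top χ)

theorem eq_of_lt_of_le_card_sq {N D K : Subgroup G} [Finite G] (hN : Nat.card N = p)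
    (hK : Nat.card K = p ^ 2) (h1 : N < D) (h2 : D ≤ K) : D = K := by
  apply Subgroup.eq_of_le_of_card_ge h2
  have hlt : Nat.card N < Nat.card D := by
    refine lt_of_le_of_ne (Subgroup.card_le_of_le h1.le) fun h => h1.ne ?_
    exact Subgroup.eq_of_le_of_card_ge h1.le h.ge
  obtain ⟨j, hj, hje⟩ := (Nat.dvd_prime_pow hp.out).mp (hK ▸ Subgroup.card_dvd_of_le h2)
  rw [hN, hje] at hlt
  have : 1 < j := by
    by_contra hle
    have := Nat.pow_le_pow_right hp.out.pos (show j ≤ 1 by omega)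
    rw [pow_one] at this
    omega
  rw [hK, hje]
  exact Nat.pow_le_pow_right hp.out.pos (by omega)

/-- Suppose [[x, y], y] = 1 always, but [[x, y], w] ≠ 1. If [x, w] is central, expanding [x, yw],
which commutes with yw, shows that [x, y] commutes with w. If not, the centraliser of w in G' is
strictly larger than N, hence all of G'. -/
theorem exists_double_commutator_ne_one {N : Subgroup G} [Finite G] (hN : Nat.card N = p)
    (hNc : N ≤ center G) (hNG : N ≤ commutator G) (hk : Nat.card (commutator G) = p ^ 2)
    (h : ¬ commutator G ≤ center G) : ∃ x y : G, ⁅⁅x, y⁆, y⁆ ≠ 1 := by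
  obtain ⟨x, y, w, hw⟩ : ∃ x y w : G, ⁅⁅x, y⁆, w⁆ ≠ 1 := by
    by_contra! hc
    refine h ?_
    rw [_root_.commutator_def, Subgroup.commutator_le]
    intro x _ y _
    rw [Subgroup.mem_center_iff]
    exact fun g => (commutatorElement_eq_one_iff_mul_comm.mp (hc x y g)).symm
  by_contra! hc
  have hcy : Commute ⁅x, y⁆ y := commutatorElement_eq_one_iff_commute.mp (hc x y)
  by_cases hxw : ⁅x, w⁆ ∈ center G
  · have h1 : ⁅x, y * w⁆ = ⁅x, y⁆ * ⁅x, w⁆ := by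
      have h2 : ⁅x, y * w⁆ = ⁅x, y⁆ * (y * ⁅x, w⁆ * y⁻¹) := by
        simp only [commutatorElement_def]; group
      rw [h2, Subgroup.mem_center_iff.mp hxw y, mul_inv_cancel_right]
    have h3 : Commute ⁅x, y * w⁆ (y * w) := commutatorElement_eq_one_iff_commute.mp (hc x (y * w))
    rw [h1] at h3
    have h4 : Commute ⁅x, w⁆ (y * w) := (Subgroup.mem_center_iff.mp hxw (y * w)).symm
    have h5 : Commute ⁅x, y⁆ (y * w) := by
      have := h3.mul_left h4.inv_left
      rwa [mul_inv_cancel_right] at this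
    have h6 : Commute ⁅x, y⁆ w := by
      have := hcy.inv_right.mul_right h5
      simpa using this
    exact hw (commutatorElement_eq_one_iff_commute.mpr h6)
  · have hxw2 : Commute ⁅x, w⁆ w := commutatorElement_eq_one_iff_commute.mp (hc x w)
    have hD : commutator G ⊓ centralizer {w} = commutator G := by
      refine eq_of_lt_of_le_card_sq (p := p) (N := N) hN hk (lt_of_le_of_ne ?_ ?_) inf_le_left
      · refine le_inf hNG (hNc.trans (center_le_centralizer _))
      · intro he
        refine hxw (hNc ?_)
        rw [he]
        exact ⟨commutatorElement_mem_commutator x w,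
          Subgroup.mem_centralizer_singleton_iff.mpr hxw2⟩
    have hmem : ⁅x, y⁆ ∈ centralizer {w} :=
      (inf_eq_left.mp hD) (commutatorElement_mem_commutator x y)
    exact hw (commutatorElement_eq_one_iff_mul_comm.mpr
      (Subgroup.mem_centralizer_singleton_iff.mp hmem))

/-- In the extremal case with `|G'| = p²` the group has class two. -/
theorem commutator_le_center_of_extremal {n : ℕ} (hG : Nat.card G = p ^ (n + 2))
    (hk : Nat.card (commutator G) = p ^ 2)
    (hM : p ^ (n + 1).choose 2 ≤ Nat.card (SchurMultiplier G)) : commutator G ≤ center G := by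
  have hfin : Finite G := Nat.finite_of_card_ne_zero (hG ▸ pow_ne_zero _ hp.out.ne_zero)
  by_contra hcen
  obtain ⟨z₀, hz₀', hz₀, ho₀⟩ := exists_mem_center_of_normal (IsPGroup.of_card hG)
    (N := commutator G) (not_comm_of_card_commutator (k := 1) hk)
  obtain ⟨N, hN⟩ : ∃ N : Subgroup G, N = zpowers z₀ := ⟨_, rfl⟩
  have hNc : N ≤ center G := hN ▸ zpowers_le.mpr hz₀
  have hnor : N.Normal := normal_of_le_center hNc
  have hNcard : Nat.card N = p := by rw [hN, Nat.card_zpowers, ho₀]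
  have hNG : N ≤ commutator G := hN ▸ zpowers_le.mpr hz₀'
  obtain ⟨hQ, hkQ, -⟩ := (extremal_of_card_commutator_sq hG hk hM hz₀' hz₀ ho₀).2 N hN
  -- The derived subgroup of G/N is normal of order p, hence central.
  have hdc : ∀ d ∈ commutator G, ∀ g, ⁅d, g⁆ ∈ N := by
    intro d hd g
    obtain ⟨ζ, hζ, -, hζQ⟩ := exists_generator_of_normal_card_prime (IsPGroup.of_card hQ) hkQ
    have h1 : (d : G ⧸ N) ∈ commutator (G ⧸ N) := by
      rw [commutator_quotient_eq_map]; exact Subgroup.mem_map_of_mem (QuotientGroup.mk' N) hd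
    rw [hζQ] at h1
    have h2 := Subgroup.mem_center_iff.mp (zpowers_le.mpr hζ h1) (g : G ⧸ N)
    have h3 : (QuotientGroup.mk' N) ⁅d, g⁆ = 1 := by
      rw [map_commutatorElement, commutatorElement_eq_one_iff_mul_comm]; exact h2.symm
    exact (QuotientGroup.eq_one_iff _).mp h3
  obtain ⟨x, y, hxy⟩ := exists_double_commutator_ne_one hNcard hNc hNG hk hcen
  have hc := commutatorElement_mem_commutator x y
  have hzN : ⁅⁅x, y⁆, y⁆ ∈ N := hdc _ hc y
  have hz : ⁅⁅x, y⁆, y⁆ ∈ center G := hNc hzN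
  have hNz : N = zpowers ⁅⁅x, y⁆, y⁆ := by
    apply le_antisymm
    · rw [hN] at hzN ⊢
      exact zpowers_le.mpr (mem_zpowers_of_orderOf_prime ho₀ hzN hxy)
    · exact zpowers_le.mpr hzN
  have ho : orderOf ⁅⁅x, y⁆, y⁆ = p := by rw [← Nat.card_zpowers, ← hNz, hNcard]
  have hxN : ⁅⁅x, y⁆, x⁆ ∈ N := hdc _ hc x
  obtain ⟨i, hi⟩ := Subgroup.mem_zpowers_iff.mp (hNz ▸ hxN)
  -- Every character is a pairing with z = [[x, y], y]. The swap identity gives F(x, z) = F(y, z^i)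
  -- = F(y, z)^i, so no character distinguishes x from y^i.
  have hsep : x * (y ^ i)⁻¹ ∈ commutator G := by
    apply mem_commutator_of_characters
    intro χ
    obtain ⟨α, hα⟩ := (extremal_of_card_commutator_sq hG hk hM (hNG hzN) hz ho).1 χ
    rw [map_mul, map_inv, map_zpow, mul_inv_eq_one, hα x, hα y,
      ← commPairing_zpow_right (Subgroup.mem_center_iff.mp hz y), hi]
    exact commPairing_commutator_swap (hNc hxN) hz
  have h1 : ⁅x, y⁆ = ⁅x * (y ^ i)⁻¹, y⁆ := by
    simp only [commutatorElement_def]; group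
  have h2 : ⁅x, y⁆ ∈ N := h1 ▸ hdc _ hsep y
  refine hxy (commutatorElement_eq_one_iff_mul_comm.mpr ?_)
  exact (Subgroup.mem_center_iff.mp (hNc h2) y).symm

end CommutatorPrimeSq

/-- An extension of an elementary abelian `p`-group `A` by an element `a` of order `p` whose
commutator map on `A` has image and kernel equal to `G'`, of order `p²`. -/
structure IsRankTwoType {G : Type} [Group G] (p : ℕ) (A : Subgroup G) (a : G) : Prop where
  comm : ∀ x ∈ A, ∀ y ∈ A, x * y = y * x
  pow_eq_one : ∀ x ∈ A, x ^ p = 1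
  a_pow : a ^ p = 1
  exists_eq : ∀ g, ∃ x ∈ A, ∃ j : ℤ, g = x * a ^ j
  dvd : ∀ j : ℤ, a ^ j ∈ A → (p : ℤ) ∣ j
  le_center : commutator G ≤ center G
  card_commutator : Nat.card (commutator G) = p ^ 2
  commutator_le : commutator G ≤ A
  mem_commutator : ∀ x ∈ A, ⁅a, x⁆ = 1 → x ∈ commutator G
  exists_commutator : ∀ d ∈ commutator G, ∃ x ∈ A, ⁅a, x⁆ = d

/-! ### The extremal case with derived subgroup of order p²: structure -/

section

variable {G : Type} [Group G] {p : ℕ} [hp : Fact p.Prime]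

theorem commutatorElement_mul_right_of_central {a x y : G} (h : ⁅a, y⁆ ∈ center G) :
    ⁅a, x * y⁆ = ⁅a, x⁆ * ⁅a, y⁆ := by
  have h2 : ⁅a, x * y⁆ = ⁅a, x⁆ * (x * ⁅a, y⁆ * x⁻¹) := by
    simp only [commutatorElement_def]; group
  rw [h2, Subgroup.mem_center_iff.mp h x, mul_inv_cancel_right]

omit hp in
-- In class two [x, y]^p = [x^p, y], and x^p is central; elements of order dividing p in the centre
-- form a subgroup.
theorem pow_eq_one_of_mem_commutator (hcen : commutator G ≤ center G)
    (hel : ∀ x : G, x ^ p ∈ commutator G) {d : G} (hd : d ∈ commutator G) : d ^ p = 1 := by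
  let K : Subgroup G :=
    { carrier := {u | u ∈ center G ∧ u ^ p = 1}
      one_mem' := ⟨one_mem _, one_pow _⟩
      mul_mem' := fun {u v} hu hv => ⟨mul_mem hu.1 hv.1, by
        rw [(show Commute u v from Subgroup.mem_center_iff.mp hv.1 u).mul_pow, hu.2, hv.2, one_mul]⟩
      inv_mem' := fun {u} hu => ⟨inv_mem hu.1, by rw [inv_pow, hu.2, inv_one]⟩ }
  suffices h : commutator G ≤ K from (h hd).2
  rw [_root_.commutator_def, Subgroup.commutator_le]
  intro x _ y _
  have hc : ⁅x, y⁆ ∈ center G := hcen (commutatorElement_mem_commutator x y)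
  refine ⟨hc, ?_⟩
  have h1 : x * y = ⁅x, y⁆ * (y * x) := by rw [commutatorElement_def]; group
  have h2 := zpow_mul_zpow_of_central hc h1 p 1
  rw [zpow_natCast, zpow_one, mul_one, zpow_natCast,
    Subgroup.mem_center_iff.mp (hcen (hel x)) y] at h2
  exact right_eq_mul.mp h2

theorem exists_zpowers_ne [Finite G] {K : Subgroup G} (hK : Nat.card K = p ^ 2)
    (hpow : ∀ d ∈ K, d ^ p = 1) :
    ∃ u ∈ K, ∃ v ∈ K, u ≠ 1 ∧ v ≠ 1 ∧ ∀ w, w ∈ zpowers u → w ∈ zpowers v → w = 1 := by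
  obtain ⟨u, hu, hu1⟩ := K.bot_or_exists_ne_one.resolve_left (by
    rintro rfl
    rw [Subgroup.card_bot] at hK
    exact (Nat.one_lt_pow (by omega) hp.out.one_lt).ne hK)
  have hou : orderOf u = p := orderOf_eq_prime (hpow u hu) hu1
  obtain ⟨v, hv, hvu⟩ : ∃ v ∈ K, v ∉ zpowers u := by
    by_contra! h
    have := Subgroup.card_le_of_le (show K ≤ zpowers u from h)
    rw [hK, Nat.card_zpowers, hou] at this
    have h2 := hp.out.two_le
    nlinarith
  have hv1 : v ≠ 1 := fun h => hvu (h ▸ one_mem _)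
  refine ⟨u, hu, v, hv, hu1, hv1, fun w hwu hwv => ?_⟩
  by_contra hw
  exact hvu (zpowers_le.mpr hwu (mem_zpowers_of_orderOf_prime (orderOf_eq_prime (hpow v hv) hv1)
    hwv hw))

/-- If `G` is generated by two elements and its centre, then `G'` is generated by their
commutator. -/
theorem commutator_le_zpowers {a b : G} (hc : ⁅a, b⁆ ∈ center G)
    (h : ∀ g : G, ∃ u ∈ center G, ∃ i j : ℤ, g = u * b ^ i * a ^ j) :
    commutator G ≤ zpowers ⁅a, b⁆ := by
  have h1 : a * b = ⁅a, b⁆ * (b * a) := by rw [commutatorElement_def]; group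
  have hz := fun k : ℤ => Subgroup.mem_center_iff.mp (zpow_mem hc k)
  have key : ∀ u ∈ center G, ∀ v ∈ center G, ∀ i j k l : ℤ,
      (u * b ^ i * a ^ j) * (v * b ^ k * a ^ l) =
        ⁅a, b⁆ ^ (j * k) * (u * v * b ^ (i + k) * a ^ (j + l)) := by
    intro u hu v hv i j k l
    calc _ = u * ((b ^ i * a ^ j) * v) * b ^ k * a ^ l := by simp only [mul_assoc]
      _ = u * v * b ^ i * (a ^ j * b ^ k) * a ^ l := by
        rw [Subgroup.mem_center_iff.mp hv]; simp only [mul_assoc]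
      _ = (u * v * b ^ i * ⁅a, b⁆ ^ (j * k)) * (b ^ k * a ^ j) * a ^ l := by
        rw [zpow_mul_zpow_of_central hc h1]; simp only [mul_assoc]
      _ = _ := by rw [hz, zpow_add, zpow_add]; simp only [mul_assoc]
  rw [_root_.commutator_def, Subgroup.commutator_le]
  intro x _ y _
  obtain ⟨u, hu, i, j, rfl⟩ := h x
  obtain ⟨v, hv, k, l, rfl⟩ := h y
  refine Subgroup.mem_zpowers_iff.mpr ⟨j * k - l * i, ?_⟩
  rw [eq_comm, commutatorElement_def, mul_inv_eq_iff_eq_mul, mul_inv_eq_iff_eq_mul,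
    key u hu v hv, mul_assoc (⁅a, b⁆ ^ _) (v * b ^ k * a ^ l), key v hv u hu,
    ← mul_assoc (⁅a, b⁆ ^ (j * k - l * i)), ← zpow_add, sub_add_cancel,
    Subgroup.mem_center_iff.mp hv u, add_comm k, add_comm l]

/-- Groups with `|G'| = p²` and large Schur multiplier are of rank two type. -/
theorem exists_isRankTwoType {n : ℕ} (hG : Nat.card G = p ^ (n + 2))
    (hk : Nat.card (commutator G) = p ^ 2)
    (hM : p ^ (n + 1).choose 2 ≤ Nat.card (SchurMultiplier G)) :
    ∃ (A : Subgroup G) (a : G), IsRankTwoType p A a := by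
  have hfin : Finite G := Nat.finite_of_card_ne_zero (hG ▸ pow_ne_zero _ hp.out.ne_zero)
  have hcen := commutator_le_center_of_extremal hG hk hM
  have hmc : ∀ x y : G, ⁅x, y⁆ ∈ center G := fun x y => hcen (commutatorElement_mem_commutator x y)
  have hext := fun {z : G} (hz' : z ∈ commutator G) (ho : orderOf z = p) =>
    extremal_of_card_commutator_sq hG hk hM hz' (hcen hz') ho
  have hel : ∀ x : G, x ^ p ∈ commutator G := by
    intro x
    obtain ⟨z, hz', hz, ho⟩ := exists_mem_center_of_normal (IsPGroup.of_card hG)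
      (N := commutator G) (not_comm_of_card_commutator (k := 1) hk)
    apply mem_commutator_of_characters
    intro χ
    obtain ⟨α, hα⟩ := (hext hz' ho).1 χ
    rw [map_pow, hα, ← zpow_natCast, ← commPairing_zpow_right (Subgroup.mem_center_iff.mp hz x),
      zpow_natCast, ← ho, pow_orderOf_eq_one, commPairing_one_right]
  have hdp : ∀ d ∈ commutator G, d ^ p = 1 := fun d hd => pow_eq_one_of_mem_commutator hcen hel hd
  -- By the Jacobi identity w pairs trivially with [x, y], and every character is such a pairing.
  have hsep : ∀ {x y w : G}, ⁅x, y⁆ ≠ 1 → ⁅y, w⁆ = 1 → ⁅w, x⁆ = 1 → w ∈ commutator G := by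
    intro x y w hxy hyw hwx
    apply mem_commutator_of_characters
    intro χ
    have hd := commutatorElement_mem_commutator x y
    obtain ⟨α, hα⟩ := (hext hd (orderOf_eq_prime (hdp _ hd) hxy)).1 χ
    have hj := commPairing_jacobi (α := α) (hmc x y) (hmc y w) (hmc w x)
    rw [hyw, hwx, commPairing_one_right, commPairing_one_right, mul_one, mul_one] at hj
    rw [hα, hj]
  have hquot : ∀ z ∈ commutator G, z ≠ 1 → ∃ N : Subgroup G, ∃ _ : N.Normal, N = zpowers z ∧
      (∃ (C : Subgroup (G ⧸ N)) (ζ a b : G ⧸ N), IsHeisenbergType p C ζ a b) ∧ p ≠ 2 := by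
    intro z hz' hz1
    have hnor : (zpowers z).Normal := normal_of_le_center (zpowers_le.mpr (hcen hz'))
    obtain ⟨hQ, hkQ, hMQ⟩ := (hext hz' (orderOf_eq_prime (hdp z hz') hz1)).2 (zpowers z) rfl
    exact ⟨zpowers z, hnor, rfl, exists_isHeisenbergType hQ hkQ
      ((Nat.pow_le_pow_right hp.out.pos (by omega)).trans hMQ), ne_two_of_card_le hQ hkQ hMQ⟩
  -- Each quotient by a subgroup of order p in G' has exponent p, and two such subgroups meet
  -- trivially.
  have hexp : ∀ g : G, g ^ p = 1 := by
    intro g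
    have hmem : ∀ z ∈ commutator G, z ≠ 1 → g ^ p ∈ zpowers z := by
      intro z hz' hz1
      obtain ⟨N, _, hN, ⟨C, ζ, a, b, hH⟩, hp2⟩ := hquot z hz' hz1
      rw [← hN, ← QuotientGroup.eq_one_iff, QuotientGroup.mk_pow]
      exact hH.pow_eq_one_of_ne_two hp2 _
    obtain ⟨u, hu, v, hv, hu1, hv1, huv⟩ := exists_zpowers_ne hk hdp
    exact huv _ (hmem u hu hu1) (hmem v hv hv1)
  obtain ⟨z, hz', z₂, -, hz1, -⟩ := exists_zpowers_ne hk hdp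
  obtain ⟨N, hnor, hN, ⟨C, ζ, a₀, b₀, hH⟩, -⟩ := hquot z hz' hz1
  -- If no such u existed, the preimage of C would be central; G would be generated by its centre
  -- and two elements, and G' would be cyclic of order at most p.
  obtain ⟨u, hucen, huN⟩ : ∃ u, u ∉ center G ∧ ∀ g, ⁅u, g⁆ ∈ N := by
    by_contra! hcon
    have hC : ∀ u : G, (u : G ⧸ N) ∈ C → u ∈ center G := by
      intro u hu
      by_contra hu'
      obtain ⟨g, hg⟩ := hcon u hu'
      refine hg ((QuotientGroup.eq_one_iff _).mp ?_)
      change (QuotientGroup.mk' N) ⁅u, g⁆ = 1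
      rw [map_commutatorElement, commutatorElement_eq_one_iff_mul_comm]
      exact (Subgroup.mem_center_iff.mp (hH.le_center hu) (g : G ⧸ N)).symm
    obtain ⟨a, rfl⟩ := QuotientGroup.mk_surjective a₀
    obtain ⟨b, rfl⟩ := QuotientGroup.mk_surjective b₀
    have hle := commutator_le_zpowers (hmc a b) (by
      intro g
      obtain ⟨c, hc, i, j, hg⟩ := hH.exists_eq (g : G ⧸ N)
      refine ⟨g * (a ^ j)⁻¹ * (b ^ i)⁻¹, hC _ ?_, i, j, by group⟩
      rw [QuotientGroup.mk_mul, QuotientGroup.mk_mul, hg]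
      simpa using hc)
    have hcard := Subgroup.card_le_of_le hle
    rw [hk, Nat.card_zpowers] at hcard
    have h3 : orderOf ⁅a, b⁆ ≤ p := orderOf_le_of_pow_eq_one hp.out.pos
      (hdp _ (commutatorElement_mem_commutator a b))
    have h2 := hp.out.two_le
    nlinarith
  obtain ⟨a, ha⟩ : ∃ a : G, ⁅u, a⁆ ≠ 1 := by
    by_contra! h
    exact hucen (Subgroup.mem_center_iff.mpr fun g =>
      (commutatorElement_eq_one_iff_mul_comm.mp (h g)).symm)
  have huG : u ∉ commutator G := fun h => hucen (hcen h)
  have hau : ⁅a, u⁆ ≠ 1 := fun h => ha (by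
    rw [commutatorElement_eq_one_iff_mul_comm] at h ⊢; exact h.symm)
  have hoz := orderOf_eq_prime (hdp z hz') hz1
  have hmemA : ∀ {x : G}, x ∈ centralizer {u} ↔ ⁅u, x⁆ = 1 := fun {x} => by
    rw [Subgroup.mem_centralizer_singleton_iff, commutatorElement_eq_one_iff_mul_comm, eq_comm]
  have hua : u * a = ⁅u, a⁆ * (a * u) := by rw [commutatorElement_def]; group
  -- The centraliser of u serves as A: two of its elements that did not commute would force u into
  -- G', hence into the centre.
  have hcomm : ∀ x ∈ centralizer {u}, ∀ y ∈ centralizer {u}, x * y = y * x := by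
    intro x hx y hy
    by_contra hxy
    refine huG (hsep (fun h => hxy (commutatorElement_eq_one_iff_mul_comm.mp h)) ?_ (hmemA.mp hx))
    rw [commutatorElement_eq_one_iff_mul_comm]
    exact (commutatorElement_eq_one_iff_mul_comm.mp (hmemA.mp hy)).symm
  have hrep : ∀ g, ∃ x ∈ centralizer {u}, ∃ j : ℤ, g = x * a ^ j := by
    intro g
    have h1 : ⁅u, a⁆ ∈ zpowers z := hN ▸ huN a
    obtain ⟨j, hj⟩ := Subgroup.mem_zpowers_iff.mp
      (zpowers_le.mpr (mem_zpowers_of_orderOf_prime hoz h1 ha) (hN ▸ huN g))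
    refine ⟨g * (a ^ j)⁻¹, hmemA.mpr ?_, j, by simp⟩
    have h2 := zpow_mul_zpow_of_central (hmc u a) hua 1 (-j)
    have h3 : ⁅u, a ^ (-j)⁆ = ⁅u, a⁆ ^ (-j) := by
      rw [commutatorElement_def, mul_inv_eq_iff_eq_mul, mul_inv_eq_iff_eq_mul, mul_assoc]
      simpa using h2
    rw [← zpow_neg, commutatorElement_mul_right_of_central (hmc _ _), h3, ← hj, ← zpow_add,
      add_neg_cancel, zpow_zero]
  have hcA : ∀ x ∈ centralizer {u}, ⁅a, x⁆ = 1 → x ∈ commutator G := by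
    intro x hx hax
    refine hsep (x := a) (y := u) hau (hmemA.mp hx) ?_
    rw [commutatorElement_eq_one_iff_mul_comm] at hax ⊢
    exact hax.symm
  refine ⟨centralizer {u}, a, hcomm, fun x _ => hexp x, hexp a, hrep, ?_, hcen, hk,
    hcen.trans (center_le_centralizer _), hcA, ?_⟩
  · intro j hj
    have h2 := zpow_mul_zpow_of_central (hmc u a) hua 1 j
    rw [zpow_one, one_mul, commutatorElement_eq_one_iff_mul_comm.mp (hmemA.mp hj)] at h2
    exact dvd_of_zpow_eq_one (hdp _ (commutatorElement_mem_commutator u a)) ha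
      (right_eq_mul.mp h2)
  -- The commutators [a, x] with x in A already form a subgroup, and it contains all commutators
  -- because G = A⟨a⟩.
  · let R : Subgroup G :=
      { carrier := {d | ∃ x ∈ centralizer {u}, ⁅a, x⁆ = d}
        one_mem' := ⟨1, one_mem _, commutatorElement_one_right a⟩
        mul_mem' := by
          rintro _ _ ⟨x, hx, rfl⟩ ⟨y, hy, rfl⟩
          exact ⟨x * y, mul_mem hx hy, commutatorElement_mul_right_of_central (hmc _ _)⟩
        inv_mem' := by
          rintro _ ⟨x, hx, rfl⟩
          refine ⟨x⁻¹, inv_mem hx, ?_⟩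
          rw [eq_inv_iff_mul_eq_one, ← commutatorElement_mul_right_of_central (hmc _ _),
            inv_mul_cancel, commutatorElement_one_right] }
    suffices h : commutator G ≤ R from fun d hd => h hd
    have hR : ∀ x ∈ centralizer {u}, ∀ i : ℤ, ⁅a ^ i, x⁆ ∈ R := by
      intro x hx i
      have h1 : a * x = ⁅a, x⁆ * (x * a) := by rw [commutatorElement_def]; group
      have h2 := zpow_mul_zpow_of_central (hmc a x) h1 i 1
      have h3 : ⁅a ^ i, x⁆ = ⁅a, x⁆ ^ i := by
        rw [commutatorElement_def, mul_inv_eq_iff_eq_mul, mul_inv_eq_iff_eq_mul, mul_assoc]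
        simpa using h2
      rw [h3]
      exact zpow_mem (show ⁅a, x⁆ ∈ R from ⟨x, hx, rfl⟩) i
    rw [_root_.commutator_def, Subgroup.commutator_le]
    intro g _ h _
    obtain ⟨x, hx, i, rfl⟩ := hrep g
    obtain ⟨y, hy, j, rfl⟩ := hrep h
    have hinv : ∀ s t : G, ⁅s, t⁆ ∈ R → ⁅t, s⁆ ∈ R := fun s t hst => by
      rw [← commutatorElement_inv]; exact inv_mem hst
    rw [commutatorElement_mul_right_of_central (hmc _ _)]
    refine mul_mem (hinv _ _ ?_) (hinv _ _ ?_)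
    · rw [commutatorElement_mul_right_of_central (hmc _ _)]
      refine mul_mem ?_ (hinv _ _ (hR y hy i))
      rw [commutatorElement_eq_one_iff_mul_comm.mpr (hcomm y hy x hx)]
      exact one_mem _
    · rw [commutatorElement_mul_right_of_central (hmc _ _)]
      refine mul_mem (hR x hx j) ?_
      rw [commutatorElement_eq_one_iff_commute.mpr ((Commute.refl a).zpow_zpow _ _)]
      exact one_mem _

end

/-! ### Square-zero maps whose kernel equals their image -/

section

variable {K V W : Type} [Field K] [AddCommGroup V] [AddCommGroup W] [Module K V] [Module K W]

/-- A linear section of T onto its range splits V into two copies of the range, on which T is a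
shift. So the dimension of the range is the only invariant. -/
theorem exists_linearEquiv_prod_range (T : V →ₗ[K] V)
    (hT : LinearMap.ker T = LinearMap.range T) :
    ∃ Φ : (LinearMap.range T × LinearMap.range T) ≃ₗ[K] V, ∀ x y, T (Φ (x, y)) = Φ (y, 0) := by
  obtain ⟨s, hs⟩ := T.rangeRestrict.exists_rightInverse_of_surjective T.range_rangeRestrict
  have hTs : ∀ y, T (s y) = y := fun y => congrArg Subtype.val (LinearMap.congr_fun hs y)
  have hT0 : ∀ x : LinearMap.range T, T x = 0 := fun x =>
    LinearMap.mem_ker.mp (hT.ge x.2)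
  let Φ : (LinearMap.range T × LinearMap.range T) →ₗ[K] V :=
    LinearMap.coprod (LinearMap.range T).subtype s
  have hΦ : ∀ x y, Φ (x, y) = x + s y := fun x y => rfl
  refine ⟨LinearEquiv.ofBijective Φ ⟨?_, ?_⟩, ?_⟩
  · rw [← LinearMap.ker_eq_bot, LinearMap.ker_eq_bot']
    rintro ⟨x, y⟩ h
    rw [hΦ] at h
    have h1 := congrArg T h
    rw [map_add, hT0, hTs, zero_add, map_zero] at h1
    have hy : y = 0 := Subtype.ext h1
    subst hy
    rw [map_zero, add_zero] at h
    have hx : x = 0 := Subtype.ext h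
    rw [hx]
    rfl
  · intro v
    have hmem : v - s (T.rangeRestrict v) ∈ LinearMap.range T := by
      refine hT.le (LinearMap.mem_ker.mpr ?_)
      rw [map_sub, hTs]
      exact sub_self (T v)
    exact ⟨(⟨_, hmem⟩, T.rangeRestrict v), by rw [hΦ]; simp⟩
  · intro x y
    change T (Φ (x, y)) = Φ (y, 0)
    rw [hΦ, hΦ, map_add, hT0, hTs, zero_add, map_zero, add_zero]

theorem exists_linearEquiv_conj [Finite K] [Finite V] [Finite W] (T : V →ₗ[K] V) (S : W →ₗ[K] W)
    (hT : LinearMap.ker T = LinearMap.range T) (hS : LinearMap.ker S = LinearMap.range S)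
    (hc : Nat.card (LinearMap.range T) = Nat.card (LinearMap.range S)) :
    ∃ e : V ≃ₗ[K] W, ∀ v, e (T v) = S (e v) := by
  have hr : Module.finrank K (LinearMap.range T) = Module.finrank K (LinearMap.range S) := by
    have h1 := Module.natCard_eq_pow_finrank (K := K) (V := LinearMap.range T)
    have h2 := Module.natCard_eq_pow_finrank (K := K) (V := LinearMap.range S)
    refine Nat.pow_right_injective (Finite.one_lt_card (α := K)) ?_
    change Nat.card K ^ _ = Nat.card K ^ _
    rw [← h1, ← h2, hc]
  let σ : LinearMap.range T ≃ₗ[K] LinearMap.range S := LinearEquiv.ofFinrankEq _ _ hr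
  obtain ⟨Φ, hΦ⟩ := exists_linearEquiv_prod_range T hT
  obtain ⟨Ψ, hΨ⟩ := exists_linearEquiv_prod_range S hS
  refine ⟨Φ.symm.trans ((LinearEquiv.prodCongr σ σ).trans Ψ), fun v => ?_⟩
  obtain ⟨⟨x, y⟩, rfl⟩ := Φ.surjective v
  rw [hΦ]
  simp [hΨ]

theorem exists_mulEquiv_conj {p : ℕ} [hp : Fact p.Prime] {A B : Type} [CommGroup A]
    [CommGroup B] [Finite A] [Finite B] (hA : ∀ a : A, a ^ p = 1) (hB : ∀ b : B, b ^ p = 1)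
    (T : A →* A) (S : B →* B) (hT : T.ker = T.range) (hS : S.ker = S.range)
    (hc : Nat.card T.range = Nat.card S.range) : ∃ e : A ≃* B, ∀ x, e (T x) = S (e x) := by
  let _ : Module (ZMod p) (Additive A) := AddCommGroup.zmodModule fun x => hA x.toMul
  let _ : Module (ZMod p) (Additive B) := AddCommGroup.zmodModule fun x => hB x.toMul
  have hfA : Finite (Additive A) := ‹Finite A›
  have hfB : Finite (Additive B) := ‹Finite B›
  let T' : Additive A →ₗ[ZMod p] Additive A :=
    AddMonoidHom.toZModLinearMap p (MonoidHom.toAdditive T)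
  let S' : Additive B →ₗ[ZMod p] Additive B :=
    AddMonoidHom.toZModLinearMap p (MonoidHom.toAdditive S)
  obtain ⟨e, he⟩ := exists_linearEquiv_conj T' S'
    (by ext x; exact SetLike.ext_iff.mp hT x.toMul) (by ext x; exact SetLike.ext_iff.mp hS x.toMul)
    hc
  exact ⟨MulEquiv.toAdditive.symm e.toAddEquiv, he⟩

end

/-! ### Uniqueness of groups of rank two type -/

namespace IsRankTwoType

variable {G : Type} [Group G] {p : ℕ} {A : Subgroup G} {a : G}

theorem commutatorElement_mem (h : IsRankTwoType p A a) (x : G) : ⁅a, x⁆ ∈ A :=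
  h.commutator_le (commutatorElement_mem_commutator a x)

/-- The commutator map `x ↦ ⁅a, x⁆` on `A`. -/
def commutatorHom (h : IsRankTwoType p A a) : A →* A where
  toFun x := ⟨⁅a, x⁆, h.commutatorElement_mem x⟩
  map_one' := Subtype.ext (commutatorElement_one_right a)
  map_mul' _ _ := Subtype.ext (commutatorElement_mul_right_of_central
    (h.le_center (commutatorElement_mem_commutator a _)))

theorem commutatorHom_apply (h : IsRankTwoType p A a) (x : A) :
    (h.commutatorHom x : G) = ⁅a, (x : G)⁆ := rfl

theorem mem_range_commutatorHom (h : IsRankTwoType p A a) {x : A} :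
    x ∈ h.commutatorHom.range ↔ (x : G) ∈ commutator G := by
  constructor
  · rintro ⟨y, rfl⟩
    exact commutatorElement_mem_commutator a _
  · intro hx
    obtain ⟨y, hy, hyx⟩ := h.exists_commutator x hx
    exact ⟨⟨y, hy⟩, Subtype.ext hyx⟩

theorem ker_commutatorHom (h : IsRankTwoType p A a) :
    h.commutatorHom.ker = h.commutatorHom.range := by
  ext x
  rw [mem_range_commutatorHom, MonoidHom.mem_ker]
  refine ⟨fun hx => h.mem_commutator x x.2 (congrArg Subtype.val hx), fun hx => Subtype.ext ?_⟩
  exact commutatorElement_eq_one_iff_mul_comm.mpr (Subgroup.mem_center_iff.mp (h.le_center hx) a)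

theorem card_range_commutatorHom (h : IsRankTwoType p A a) :
    Nat.card h.commutatorHom.range = p ^ 2 := by
  rw [← h.card_commutator]
  exact Nat.card_congr
    { toFun := fun x => ⟨x.1, h.mem_range_commutatorHom.mp x.2⟩
      invFun := fun d => ⟨⟨d.1, h.commutator_le d.2⟩, h.mem_range_commutatorHom.mpr d.2⟩
      left_inv := fun _ => rfl
      right_inv := fun _ => rfl }

/-- The product involves only A and the commutator map, so an isomorphism of the groups A that
intertwines these maps extends to the whole group. -/
theorem mul_mul_eq (h : IsRankTwoType p A a) (x y : A) (i j : ℤ) :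
    ((x : G) * a ^ i) * ((y : G) * a ^ j) =
      ((x * h.commutatorHom y ^ i * y : A) : G) * a ^ (i + j) := by
  have hc : ⁅a, (y : G)⁆ ∈ center G := h.le_center (commutatorElement_mem_commutator a _)
  have h1 : a * y = ⁅a, (y : G)⁆ * (y * a) := by rw [commutatorElement_def]; group
  have h2 := zpow_mul_zpow_of_central hc h1 i 1
  rw [zpow_one, mul_one] at h2
  calc _ = (x : G) * (a ^ i * y) * a ^ j := by simp only [mul_assoc]
    _ = _ := by
      rw [h2, zpow_add]
      simp only [Subgroup.coe_mul, SubgroupClass.coe_zpow, commutatorHom_apply, mul_assoc]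

theorem inv_eq (h : IsRankTwoType p A a) (x : A) (i : ℤ) :
    ((x : G) * a ^ i)⁻¹ = ((h.commutatorHom x⁻¹ ^ (-i) * x⁻¹ : A) : G) * a ^ (-i) := by
  have := h.mul_mul_eq 1 x⁻¹ (-i) 0
  rw [mul_inv_rev, ← zpow_neg]
  simpa using this

theorem fibre_eq_one (h : IsRankTwoType p A a) {H : Type} [Group H] {B : Subgroup H} {b : H}
    (h' : IsRankTwoType p B b) (θ : A →* B) (x : A) (i : ℤ) (he : (x : G) * a ^ i = 1) :
    (θ x : H) * b ^ i = 1 := by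
  have hmem : a ^ i ∈ A := by
    rw [← inv_eq_of_mul_eq_one_right he]; exact inv_mem x.2
  obtain ⟨k, rfl⟩ := h.dvd i hmem
  rw [zpow_mul, zpow_natCast, h.a_pow, one_zpow, mul_one] at he
  rw [zpow_mul, zpow_natCast, h'.a_pow, one_zpow, mul_one, show x = 1 from Subtype.ext he]
  simp

/-- Any two groups of rank two type (for the same prime) are isomorphic. -/
theorem nonempty_mulEquiv [hp : Fact p.Prime] [Finite G] (h : IsRankTwoType p A a) {H : Type}
    [Group H] [Finite H] {B : Subgroup H} {b : H} (h' : IsRankTwoType p B b) :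
    Nonempty (G ≃* H) := by
  let _ : CommGroup A := { (inferInstance : Group A) with
    mul_comm := fun x y => Subtype.ext (h.comm x x.2 y y.2) }
  let _ : CommGroup B := { (inferInstance : Group B) with
    mul_comm := fun x y => Subtype.ext (h'.comm x x.2 y y.2) }
  obtain ⟨θ, hθ⟩ := exists_mulEquiv_conj (p := p) (A := A) (B := B)
    (fun x => Subtype.ext (by simpa using h.pow_eq_one x x.2))
    (fun x => Subtype.ext (by simpa using h'.pow_eq_one x x.2)) h.commutatorHom h'.commutatorHom
    h.ker_commutatorHom h'.ker_commutatorHom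
    (h.card_range_commutatorHom.trans h'.card_range_commutatorHom.symm)
  let Γ : Subgroup (G × H) :=
    { carrier := {q | ∃ (x : A) (i : ℤ), q = ((x : G) * a ^ i, (θ x : H) * b ^ i)}
      one_mem' := ⟨1, 0, by simp; rfl⟩
      mul_mem' := by
        rintro _ _ ⟨x, i, rfl⟩ ⟨y, j, rfl⟩
        refine ⟨x * h.commutatorHom y ^ i * y, i + j, ?_⟩
        rw [Prod.mk_mul_mk, h.mul_mul_eq, h'.mul_mul_eq, map_mul, map_mul, map_zpow, hθ]
      inv_mem' := by
        rintro _ ⟨x, i, rfl⟩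
        refine ⟨h.commutatorHom x⁻¹ ^ (-i) * x⁻¹, -i, ?_⟩
        rw [Prod.inv_mk, h.inv_eq, h'.inv_eq, map_mul θ, map_zpow θ, hθ, map_inv θ] }
  refine exists_mulEquiv_of_graph Γ ?_ ?_ ?_ ?_
  · intro g
    obtain ⟨x, hx, i, rfl⟩ := h.exists_eq g
    exact ⟨_, ⟨x, hx⟩, i, rfl⟩
  · intro g
    obtain ⟨x, hx, i, rfl⟩ := h'.exists_eq g
    exact ⟨_, θ.symm ⟨x, hx⟩, i, by simp; rfl⟩
  · rintro g ⟨x, i, e⟩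
    rw [Prod.mk.injEq] at e
    rw [e.2]
    exact h.fibre_eq_one h' θ.toMonoidHom x i e.1.symm
  · rintro g ⟨x, i, e⟩
    rw [Prod.mk.injEq] at e
    rw [e.1]
    simpa using h'.fibre_eq_one h θ.symm.toMonoidHom (θ x) i e.2.symm

end IsRankTwoType

/-! ### Comparison with the cohomology group of the statement -/

section Comparison

theorem exists_addEquiv_of_ker_eq {A B M : Type*} [AddGroup A] [AddGroup B] [Group M] (f : A →+ B)
    (g : A →+ Additive M) (hf : Function.Surjective f) (hg : Function.Surjective g)
    (h : f.ker = g.ker) : ∃ e : B ≃+ Additive M, ∀ a, e (f a) = g a := by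
  let e₁ := QuotientAddGroup.quotientKerEquivOfSurjective f hf
  let e₂ := QuotientAddGroup.quotientKerEquivOfSurjective g hg
  refine ⟨(e₁.symm.trans (QuotientAddGroup.quotientAddEquivOfEq h)).trans e₂, fun a => ?_⟩
  have : e₁.symm (f a) = (a : A ⧸ f.ker) := by rw [AddEquiv.symm_apply_eq]; rfl
  simp only [AddEquiv.trans_apply, this]
  rfl

variable {G : Type} [Group G]

/-- Multiplicative form of a 2-cocycle. -/
def TwoCocycle.toSchur : TwoCocycle ℂ G →+ Additive (schurCocycles G) where
  toFun α := Additive.ofMul ⟨fun g h => α.val g h, fun g h j => α.val_mul_val g h j⟩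
  map_zero' := rfl
  map_add' _ _ := rfl

theorem TwoCocycle.toSchur_surjective :
    Function.Surjective (TwoCocycle.toSchur (G := G)) := by
  intro β
  refine ⟨⟨fun q => Additive.ofMul (β.toMul.1 q.1 q.2), ?_⟩, rfl⟩
  exact (groupCohomology.mem_cocycles₂_iff (A := unitsRep ℂ G) _).2
    fun g h j => schurCocycles_apply β.toMul g h j

theorem TwoCocycle.cohomologyClass_eq_zero_iff (α : TwoCocycle ℂ G) :
    α.cohomologyClass = 0 ↔ α.toSchur.toMul ∈ schurBoundaries G := by
  rw [mem_schurBoundaries]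
  refine (groupCohomology.H2π_eq_zero_iff (A := unitsRep ℂ G) α).trans ?_
  constructor
  · rintro ⟨l, hl⟩
    refine ⟨fun g => (l g).toMul, fun g h => ?_⟩
    have := congrArg Additive.toMul (congrFun hl (g, h))
    exact this
  · rintro ⟨l, hl⟩
    refine ⟨fun g => Additive.ofMul (l g), ?_⟩
    funext q
    exact congrArg Additive.ofMul (hl q.1 q.2)

/-- The cohomology class as an additive homomorphism. -/
noncomputable def TwoCocycle.classHom : TwoCocycle ℂ G →+ SecondCohomology ℂ G :=
  (groupCohomology.H2π (unitsRep ℂ G)).hom.toAddMonoidHom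

theorem TwoCocycle.classHom_apply (α : TwoCocycle ℂ G) :
    TwoCocycle.classHom α = α.cohomologyClass := rfl

theorem TwoCocycle.classHom_surjective :
    Function.Surjective (TwoCocycle.classHom (G := G)) :=
  (ModuleCat.epi_iff_surjective (groupCohomology.H2π (unitsRep ℂ G))).mp inferInstance

/-- The class of a cocycle in the multiplicative Schur multiplier. -/
def TwoCocycle.schurClass : TwoCocycle ℂ G →+ Additive (SchurMultiplier G) :=
  (MonoidHom.toAdditive (QuotientGroup.mk' (schurBoundaries G))).comp TwoCocycle.toSchur

theorem TwoCocycle.schurClass_apply (α : TwoCocycle ℂ G) :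
    TwoCocycle.schurClass α = Additive.ofMul (QuotientGroup.mk α.toSchur.toMul) := rfl

theorem TwoCocycle.schurClass_surjective :
    Function.Surjective (TwoCocycle.schurClass (G := G)) := by
  intro q
  obtain ⟨β, hβ⟩ := QuotientGroup.mk_surjective q.toMul
  obtain ⟨α, hα⟩ := TwoCocycle.toSchur_surjective (Additive.ofMul β)
  refine ⟨α, ?_⟩
  rw [TwoCocycle.schurClass_apply, hα, toMul_ofMul, hβ, ofMul_toMul]

theorem TwoCocycle.ker_classHom :
    (TwoCocycle.classHom (G := G)).ker = (TwoCocycle.schurClass (G := G)).ker := by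
  ext α
  rw [AddMonoidHom.mem_ker, AddMonoidHom.mem_ker, TwoCocycle.classHom_apply,
    TwoCocycle.cohomologyClass_eq_zero_iff, TwoCocycle.schurClass_apply]
  exact (QuotientGroup.eq_one_iff _).symm

/-- Both groups are quotients of the 2-cocycles by the same coboundaries. -/
theorem exists_secondCohomology_equiv (G : Type) [Group G] :
    ∃ e : SecondCohomology ℂ G ≃+ Additive (SchurMultiplier G),
      ∀ α : TwoCocycle ℂ G, e α.cohomologyClass = TwoCocycle.schurClass α := by
  obtain ⟨e, he⟩ := exists_addEquiv_of_ker_eq TwoCocycle.classHom TwoCocycle.schurClass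
    (TwoCocycle.classHom_surjective (G := G)) TwoCocycle.schurClass_surjective
    TwoCocycle.ker_classHom
  exact ⟨e, he⟩

theorem card_secondCohomology (G : Type) [Group G] :
    Nat.card (SecondCohomology ℂ G) = Nat.card (SchurMultiplier G) := by
  obtain ⟨e, -⟩ := exists_secondCohomology_equiv G
  exact Nat.card_congr e.toEquiv

end Comparison

/-! ### Isomorphic groups are twist isomorphic -/

section Transport

variable {G H : Type} [Group G] [Group H]

open TwistedGroupAlgebra in
/-- Twisted group algebras of cocycles that differ by an isomorphism and a coboundary. -/
theorem nonempty_algEquiv_of_coboundary (f : G ≃* H) (α : TwoCocycle ℂ G) (β : TwoCocycle ℂ H)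
    (c : H → ℂˣ) (hc : ∀ g h : G, α.val g h * (c (f h) * (c (f (g * h)))⁻¹ * c (f g)) =
      β.val (f g) (f h)) : Nonempty (TwistedGroupAlgebra α ≃ₐ[ℂ] TwistedGroupAlgebra β) := by
  let T : TwistedGroupAlgebra α ≃ₗ[ℂ] TwistedGroupAlgebra β :=
    (basis α).equiv ((basis β).unitsSMul fun h => (c h)⁻¹) f.toEquiv
  have hT : ∀ g, T (basis α g) = (((c (f g))⁻¹ : ℂˣ) : ℂ) • basis β (f g) := by
    intro g
    simp only [T, Module.Basis.equiv_apply, Module.Basis.unitsSMul_apply]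
    rfl
  have hmul : ∀ x y, T (x * y) = T x * T y := by
    have h1 : ∀ g, T.toLinearMap ∘ₗ mulLin α (basis α g) =
        mulLin β (T (basis α g)) ∘ₗ T.toLinearMap := fun g => (basis α).ext fun h => by
      simp only [LinearMap.comp_apply, LinearEquiv.coe_coe, mulLin_basis, map_smul, hT,
        LinearMap.smul_apply, smul_smul, map_mul]
      congr 1
      have := congrArg Units.val (hc g h)
      rw [← Units.val_mul, ← Units.val_mul, ← Units.val_mul, Units.val_inj, ← hc g h]
      rw [map_mul]
      have e : (c (f h))⁻¹ * (c (f g))⁻¹ *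
          (α.val g h * (c (f h) * (c (f g * f h))⁻¹ * c (f g))) =
          ((c (f h))⁻¹ * c (f h)) * ((c (f g))⁻¹ * c (f g)) * (α.val g h * (c (f g * f h))⁻¹) := by
        simp only [mul_comm, mul_left_comm, mul_assoc]
      simpa [mul_comm, mul_left_comm, mul_assoc] using e.symm
    have h2 : ∀ y, T.toLinearMap ∘ₗ (mulLin α).flip y =
        (mulLin β).flip (T y) ∘ₗ T.toLinearMap := fun y => (basis α).ext fun g =>
      LinearMap.congr_fun (h1 g) y
    exact fun x y => LinearMap.congr_fun (h2 y) x
  -- A multiplicative bijection preserves the unit, which avoids computing with α(1, 1)⁻¹.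
  have hone : T 1 = 1 := by
    have h1 := hmul 1 (T.symm 1)
    rw [one_mul, LinearEquiv.apply_symm_apply, mul_one] at h1
    exact h1.symm
  exact ⟨AlgEquiv.ofLinearEquiv T hone hmul⟩

theorem schurMap_comp_symm (f : G ≃* H) (q : SchurMultiplier G) :
    schurMap f.toMonoidHom (schurMap f.symm.toMonoidHom q) = q := by
  obtain ⟨α, rfl⟩ := QuotientGroup.mk_surjective q
  rw [schurMap_mk, schurMap_mk]
  congr 1
  apply Subtype.ext
  funext g h
  simp

/-- Isomorphic groups have isomorphic Schur multipliers. -/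
def schurEquiv (f : G ≃* H) : SchurMultiplier G ≃* SchurMultiplier H :=
  { schurMap f.symm.toMonoidHom with
    invFun := schurMap f.toMonoidHom
    left_inv := schurMap_comp_symm f
    right_inv := schurMap_comp_symm f.symm }

theorem schurEquiv_mk (f : G ≃* H) (α : schurCocycles G) :
    schurEquiv f (QuotientGroup.mk α) = QuotientGroup.mk (schurComap f.symm.toMonoidHom α) := rfl

theorem twistIsomorphic_of_mulEquiv (f : G ≃* H) : TwistIsomorphic ℂ G H := by
  obtain ⟨eG, heG⟩ := exists_secondCohomology_equiv G
  obtain ⟨eH, heH⟩ := exists_secondCohomology_equiv H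
  refine ⟨(eG.trans (MulEquiv.toAdditive (schurEquiv f))).trans eH.symm, fun α β h => ?_⟩
  rw [AddEquiv.trans_apply, AddEquiv.symm_apply_eq, AddEquiv.trans_apply, heG, heH] at h
  have h1 : schurEquiv f (QuotientGroup.mk α.toSchur.toMul) =
      (QuotientGroup.mk β.toSchur.toMul : SchurMultiplier H) := congrArg Additive.toMul h
  rw [schurEquiv_mk, QuotientGroup.eq] at h1
  obtain ⟨c, hc⟩ := mem_schurBoundaries.mp h1
  refine nonempty_algEquiv_of_coboundary f α β c fun g k => ?_
  have h2 := hc (f g) (f k)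
  have h3 : ((schurComap f.symm.toMonoidHom α.toSchur.toMul)⁻¹ * β.toSchur.toMul).1 (f g) (f k) =
      (α.val (f.symm (f g)) (f.symm (f k)))⁻¹ * β.val (f g) (f k) := rfl
  rw [h3, MulEquiv.symm_apply_apply, MulEquiv.symm_apply_apply, eq_inv_mul_iff_mul_eq] at h2
  rw [map_mul, h2]

end Transport

/-! ### Invariants of twist isomorphism -/

section Invariants

open TwistedGroupAlgebra

/-- Algebra homomorphisms of the untwisted group algebra correspond to characters. -/
theorem card_algHom_twistedGroupAlgebra_zero (G : Type) [Group G] :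
    Nat.card (TwistedGroupAlgebra (0 : TwoCocycle ℂ G) →ₐ[ℂ] ℂ) = Nat.card (G →* ℂˣ) := by
  have hmul : ∀ g h : G, basis (0 : TwoCocycle ℂ G) g * basis (0 : TwoCocycle ℂ G) h =
      basis (0 : TwoCocycle ℂ G) (g * h) := by
    intro g h
    rw [basis_mul_basis, show (0 : TwoCocycle ℂ G).val g h = 1 from rfl, Units.val_one, one_smul]
  have hone : basis (0 : TwoCocycle ℂ G) 1 = 1 := by
    rw [one_def, show (0 : TwoCocycle ℂ G).val 1 1 = 1 from rfl, inv_one, Units.val_one, one_smul]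
  let F : (TwistedGroupAlgebra (0 : TwoCocycle ℂ G) →ₐ[ℂ] ℂ) → (G →* ℂˣ) := fun φ =>
    MonoidHom.toHomUnits
      { toFun := fun g => φ (basis (0 : TwoCocycle ℂ G) g)
        map_one' := by rw [hone, map_one]
        map_mul' := fun g h => by rw [← hmul, map_mul] }
  have hF : ∀ φ g, ((F φ g : ℂˣ) : ℂ) = φ (basis (0 : TwoCocycle ℂ G) g) := fun φ g => rfl
  refine Nat.card_congr (Equiv.ofBijective F ⟨?_, ?_⟩)
  · intro φ ψ h
    have : φ.toLinearMap = ψ.toLinearMap := (basis (0 : TwoCocycle ℂ G)).ext fun g => by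
      rw [AlgHom.toLinearMap_apply, AlgHom.toLinearMap_apply, ← hF, ← hF, h]
    exact AlgHom.toLinearMap_injective this
  · intro χ
    let l : TwistedGroupAlgebra (0 : TwoCocycle ℂ G) →ₗ[ℂ] ℂ :=
      (basis (0 : TwoCocycle ℂ G)).constr ℂ fun g => (χ g : ℂ)
    have hl : ∀ g, l (basis (0 : TwoCocycle ℂ G) g) = χ g := fun g =>
      Module.Basis.constr_basis _ _ _ _
    have h1 : ∀ g, l ∘ₗ mulLin 0 (basis (0 : TwoCocycle ℂ G) g) = (χ g : ℂ) • l := fun g =>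
      (basis (0 : TwoCocycle ℂ G)).ext fun h => by
        rw [LinearMap.comp_apply, ← mul_def, hmul, hl, LinearMap.smul_apply, hl, map_mul,
          Units.val_mul, smul_eq_mul]
    have h2 : ∀ y, l ∘ₗ (mulLin 0).flip y = l y • l := fun y =>
      (basis (0 : TwoCocycle ℂ G)).ext fun g => by
        have := LinearMap.congr_fun (h1 g) y
        rw [LinearMap.smul_apply, hl, smul_eq_mul, mul_comm]
        exact this
    refine ⟨AlgHom.ofLinearMap l (by rw [← hone, hl, map_one, Units.val_one]) fun x y => ?_, ?_⟩
    · have := LinearMap.congr_fun (h2 y) x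
      rw [LinearMap.smul_apply, smul_eq_mul, mul_comm] at this
      exact this
    · ext g
      rw [hF]
      exact hl g

theorem card_characters (G : Type) [Group G] [Finite G] :
    Nat.card (G →* ℂˣ) = (commutator G).index := by
  rw [Nat.card_congr (Abelianization.lift (G := G) (A := ℂˣ)),
    CommGroup.card_monoidHom_of_hasEnoughRootsOfUnity]
  rfl

/-- The isomorphism ψ fixes the trivial class, so the untwisted group algebras are isomorphic and
have equally many homomorphisms to ℂ. -/
theorem TwistIsomorphic.index_commutator_eq {G H : Type} [Group G] [Group H] [Finite G] [Finite H]
    (h : TwistIsomorphic ℂ G H) : (commutator G).index = (commutator H).index := by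
  obtain ⟨ψ, hψ⟩ := h
  have h0 : ψ (0 : TwoCocycle ℂ G).cohomologyClass = (0 : TwoCocycle ℂ H).cohomologyClass := by
    rw [← TwoCocycle.classHom_apply, ← TwoCocycle.classHom_apply, map_zero, map_zero, map_zero]
  obtain ⟨e⟩ := hψ 0 0 h0
  rw [← card_characters, ← card_characters, ← card_algHom_twistedGroupAlgebra_zero,
    ← card_algHom_twistedGroupAlgebra_zero]
  exact Nat.card_congr (e.arrowCongr AlgEquiv.refl)

theorem TwistIsomorphic.card_schurMultiplier_eq {G H : Type} [Group G] [Group H]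
    (h : TwistIsomorphic ℂ G H) : Nat.card (SchurMultiplier G) = Nat.card (SchurMultiplier H) := by
  obtain ⟨ψ, -⟩ := h
  rw [← card_secondCohomology, ← card_secondCohomology]
  exact Nat.card_congr ψ.toEquiv

end Invariants

/-! ### Conclusion -/

theorem HasGeneralizedCorank.pow_choose_le {p n : ℕ} (hp : p.Prime) {G : Type} [Group G] {s : ℤ}
    (hs : s ≤ 1) (h : HasGeneralizedCorank p (n + 1) G s) :
    p ^ n.choose 2 ≤ Nat.card (SchurMultiplier G) := by
  have h1 : (((n + 1 : ℕ) : ℤ) - 1) * (((n + 1 : ℕ) : ℤ) - 2) / 2 = (n.choose 2 : ℤ) := by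
    rcases n with _ | n
    · simp
    · rw [Nat.choose_two_right]
      push_cast
      congr 1
      ring
  have h2 := h
  unfold HasGeneralizedCorank at h2
  rw [h1, card_secondCohomology] at h2
  have hp1 : (1 : ℚ) ≤ p := by exact_mod_cast hp.one_lt.le
  have h3 : ((p ^ n.choose 2 : ℕ) : ℚ) ≤ (Nat.card (SchurMultiplier G) : ℚ) := by
    rw [h2, Nat.cast_pow, ← zpow_natCast]
    exact zpow_le_zpow_right₀ hp1 (by linarith)
  exact_mod_cast h3

/-- Two groups of order `p ^ (n + 1)` with derived subgroups of the same order `> 1` and large Schur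
multipliers are isomorphic. -/
theorem nonempty_mulEquiv_of_card_schurMultiplier {p n k : ℕ} [hp : Fact p.Prime] {G H : Type}
    [Group G] [Group H] (hG : Nat.card G = p ^ (n + 1)) (hH : Nat.card H = p ^ (n + 1))
    (hkG : Nat.card (commutator G) = p ^ (k + 1)) (hkH : Nat.card (commutator H) = p ^ (k + 1))
    (hMG : p ^ n.choose 2 ≤ Nat.card (SchurMultiplier G))
    (hMH : p ^ n.choose 2 ≤ Nat.card (SchurMultiplier H)) : Nonempty (G ≃* H) := by
  have hfG : Finite G := Nat.finite_of_card_ne_zero (hG ▸ pow_ne_zero _ hp.out.ne_zero)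
  have hfH : Finite H := Nat.finite_of_card_ne_zero (hH ▸ pow_ne_zero _ hp.out.ne_zero)
  -- The lower and upper bounds together give k + (n choose 2) ≤ (n choose 2) + 1.
  have hk : k ≤ 1 := by
    obtain ⟨-, hb⟩ := card_schurMultiplier_nonabelian k n G hG hkG
    have h1 := (Nat.mul_le_mul_left (p ^ k) hMG).trans hb
    rw [← pow_add, Nat.pow_le_pow_iff_right hp.out.one_lt] at h1
    omega
  obtain rfl | rfl : k = 0 ∨ k = 1 := by omega
  · rw [zero_add, pow_one] at hkG hkH
    obtain ⟨C, z, a, b, h⟩ := exists_isHeisenbergType hG hkG hMG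
    obtain ⟨C', z', a', b', h'⟩ := exists_isHeisenbergType hH hkH hMH
    exact h.nonempty_mulEquiv h' (hG.trans hH.symm)
  · have hn : n ≠ 0 := by
      rintro rfl
      have h1 : p ^ 2 ∣ p ^ 1 := by
        rw [show p ^ 2 = Nat.card (commutator G) from hkG.symm, ← hG]
        exact Subgroup.card_subgroup_dvd_card _
      have := (Nat.pow_dvd_pow_iff_le_right hp.out.one_lt).mp h1
      omega
    obtain ⟨n, rfl⟩ := Nat.exists_eq_succ_of_ne_zero hn
    obtain ⟨A, a, h⟩ := exists_isRankTwoType hG hkG hMG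
    obtain ⟨B, b, h'⟩ := exists_isRankTwoType hH hkH hMH
    exact h.nonempty_mulEquiv h'

theorem mainTheorem3 (p n : ℕ) (hp : p.Prime) (G : Type) [Group G]
    (hcard : Nat.card G = p ^ n) (hnonab : ¬ ∀ a b : G, a * b = b * a)
    (s : ℤ) (hs : s = 0 ∨ s = 1) (hG : HasGeneralizedCorank p n G s)
    (H : Type) [Group H] (hH : Nat.card H = p ^ n) :
    TwistIsomorphic ℂ G H ↔ Nonempty (G ≃* H) := by
  refine ⟨fun h => ?_, fun ⟨f⟩ => twistIsomorphic_of_mulEquiv f⟩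
  have : Fact p.Prime := ⟨hp⟩
  have hfG : Finite G := Nat.finite_of_card_ne_zero (hcard ▸ pow_ne_zero _ hp.ne_zero)
  have hfH : Finite H := Nat.finite_of_card_ne_zero (hH ▸ pow_ne_zero _ hp.ne_zero)
  have hne : commutator G ≠ ⊥ := fun hb => hnonab (comm_of_commutator_eq_bot hb)
  obtain ⟨k, -, hk⟩ := (Nat.dvd_prime_pow hp).mp
    (hcard ▸ Subgroup.card_subgroup_dvd_card (commutator G))
  have hk0 : k ≠ 0 := by
    rintro rfl
    exact hne (Subgroup.card_eq_one.mp (by simpa using hk))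
  have hn0 : n ≠ 0 := by
    rintro rfl
    have := Subgroup.card_subgroup_dvd_card (commutator G)
    rw [hcard, pow_zero, Nat.dvd_one] at this
    exact hne (Subgroup.card_eq_one.mp this)
  obtain ⟨k, rfl⟩ := Nat.exists_eq_succ_of_ne_zero hk0
  obtain ⟨n, rfl⟩ := Nat.exists_eq_succ_of_ne_zero hn0
  -- The orders of the groups and the indices of their derived subgroups agree.
  have hkH : Nat.card (commutator H) = p ^ (k + 1) := by
    have h1 := Subgroup.card_mul_index (commutator G)
    have h2 := Subgroup.card_mul_index (commutator H)
    rw [hH, ← hcard, ← h1, h.index_commutator_eq] at h2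
    rw [Nat.eq_of_mul_eq_mul_right (Nat.pos_of_ne_zero (commutator H).index_ne_zero_of_finite) h2,
      hk]
  have hM := hG.pow_choose_le hp (by omega)
  exact nonempty_mulEquiv_of_card_schurMultiplier hcard hH hk hkH hM
    (h.card_schurMultiplier_eq ▸ hM)
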